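/- Fix an integer $K\ge 2$ and a real number $C$. For $n\ge 1$ and $0<\rho<\theta\le\frac12$ let $\mathrm{SBM}(n,K,\theta,\rho)$ be the random simple graph on $nK$ vertices, divided into $K$ communities of size $n$, whose edges are independent Bernoulli variables, of mean $\theta$ for two vertices of the same community and of mean $\rho$ for two vertices of different communities. Let $\mathcal Y$ be its adjacency matrix (with zero diagonal), $\mathcal C_i=\{k:\mathcal Y_{ik}=1\}$ the neighbourhood of $i$, and let $W^*_{ij}=1$ if $i,j$ lie in the same community and $W^*_{ij}=0$ otherwise. One step of the algorithm with threshold $\lambda\in\mathbb R$, started from the neighbourhoods $\mathcal C_i$, is defined as follows. For all vertices $i,j$ (including $i=j$) put $N_{ij}=|\mathcal C_i|\,(|\mathcal C_j|-\mathbb 1(i=j))$ and \[ S_{ij}=(\mathcal Y^3)_{ij}\ \text{ for } \mathrm{AWCD}_1^\circ,\qquad S_{ij}=(\mathcal Y^3)_{ij}-\mathbb 1(\mathcal Y_{ij}=1)\,(|\mathcal C_i|+|\mathcal C_j|-1)\ \text{ for } \mathrm{AWCD}_1, \] \[ \widetilde\theta_{ij}=\frac{S_{ij}}{N_{ij}},\qquad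 \widetilde\theta_{i\vee j}=\frac{S_{ii}+2S_{ij}+S_{jj}}{N_{ii}+2N_{ij}+N_{jj}}, \] \[ T_{ij}=N_{ii}\,\mathcal K(\widetilde\theta_{ii},\widetilde\theta_{i\vee j})+N_{jj}\,\mathcal K(\widetilde\theta_{jj},\widetilde\theta_{i\vee j})+N_{ij}\,\mathcal K(\widetilde\theta_{ij},\widetilde\theta_{i\vee j}),\qquad W_{ij}=\mathbb 1(T_{ij}\le\lambda), \] where $\mathcal K(p,q)=p\log\frac pq+(1-p)\log\frac{1-p}{1-q}$ is the Kullback–Leibler divergence of Bernoulli laws, and a summand with factor $N=0$ is read as $0$. In each of the following four cases there is a constant $c>0$, depending only on $K$ and $C$, such that for all sequences $\theta=\theta_n$, $\rho=\rho_n$ in $[0,1]$ which for all sufficiently large $n$ satisfy $0<\rho<\theta\le\frac12$ and the stated conditions, there are thresholds $\lambda=\lambda_n\in\mathbb R$ for which the output $W$ of the stated algorithm on $\mathrm{SBM}(n,K,\theta_n,\rho_n)$ satisfies \[ \mathbb P\left(\forall i,j:\ W_{ij}=W^*_{ij}\right)\to 1\qquad (n\to\infty). \] 1. $\mathrm{AWCD}_1^\circ$,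 if $\frac\theta\rho = C$ and $c\,\theta>n^{-\frac12}$. 2. $\mathrm{AWCD}_1^\circ$, if $\frac\theta\rho\le C$ and $c\,(\theta-\rho)>\max\{n^{-\frac13}\theta^{\frac13},\ n^{-\frac16}\theta^{\frac56}(\log n)^{\frac16}\}$. 3. $\mathrm{AWCD}_1$, if $\frac\theta\rho = C$ and $c\,\theta>n^{-\frac23}(\log n)^{\frac13}$. 4. $\mathrm{AWCD}_1$, if $\frac\theta\rho\le C$ and $c\,(\theta-\rho)>\max\{n^{-\frac13}\theta^{\frac12}(\log n)^{\frac16},\ n^{-\frac16}\theta^{\frac56}(\log n)^{\frac16}\}$. -/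

import Mathlib

open MeasureTheory ProbabilityTheory Filter Topology
open scoped unitInterval

noncomputable section

/-! The symmetric stochastic block model `SBM(n, K, θ, ρ)`. -/

/-- The `n * K` vertices, split into `K` communities of size `n`;
the first coordinate is the community of a vertex. -/
abbrev Vertex (K n : ℕ) : Type := Fin K × Fin n

/-- The edge probability of an unordered pair of vertices: `θ` inside a community,
`ρ` between different communities. -/
def edgeProb {K n : ℕ} (θ ρ : I) : Sym2 (Vertex K n) → I :=
  Sym2.lift ⟨fun u v => if u.1 = v.1 then θ else ρ, fun u v => by simp only [eq_comm]⟩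

/-- The joint law of the independent Bernoulli edge indicators, one for each unordered pair.
(The indicators of the degenerate pairs `s(v, v)` are never used, see `adjacency`.) -/
def sbmMeasure (K n : ℕ) (θ ρ : I) : Measure (Sym2 (Vertex K n) → Bool) :=
  Measure.pi fun e => bernoulliMeasure true false (edgeProb θ ρ e)

instance sbmMeasure_isProbabilityMeasure (K n : ℕ) (θ ρ : I) :
    IsProbabilityMeasure (sbmMeasure K n θ ρ) := by
  unfold sbmMeasure
  infer_instance

/-- The adjacency matrix of the random graph: symmetric, with entries `0` and `1` and without
self-loops. -/
def adjacency {K n : ℕ} (ω : Sym2 (Vertex K n) → Bool) :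
    Matrix (Vertex K n) (Vertex K n) ℝ :=
  fun i j => if i ≠ j ∧ ω s(i, j) = true then 1 else 0

/-- The true weight matrix `W*`: `W* i j = 1` iff `i` and `j` are in the same community. -/
def trueWeights (K n : ℕ) : Matrix (Vertex K n) (Vertex K n) ℝ :=
  fun i j => if i.1 = j.1 then 1 else 0

/-! The adaptive weights community detection algorithm. -/

/-- Kullback-Leibler divergence of the Bernoulli laws with means `p` and `q`, with the
convention `0 * log 0 = 0`. In the algorithm, `q` is a weighted mean of the values `p ∈ [0, 1]`,
so `q ∈ {0, 1}` and `p ≠ q` (infinite divergence) can only occur with `p` of weight zero. -/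
def bernoulliKL (p q : ℝ) : ℝ :=
  p * Real.log (p / q) + (1 - p) * Real.log ((1 - p) / (1 - q))

section Algorithm

variable {V : Type*} [Fintype V] [DecidableEq V]

/-- `|C_i|`, the size of the local community `C_i = {k : W i k = 1}`. -/
def localSize (W : Matrix V V ℝ) (i : V) : ℝ :=
  ((Finset.univ.filter fun k => W i k = 1).card : ℝ)

/-- `S = W Y W`, as in the original algorithm. -/
def edgeCount (Y W : Matrix V V ℝ) : Matrix V V ℝ :=
  W * Y * W

/-- `S_ij = (W Y W)_ij - 1(Y_ij = 1) (|C_i| + |C_j| - 1)`, the bias-corrected version. -/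
def debiasedEdgeCount (Y W : Matrix V V ℝ) : Matrix V V ℝ :=
  fun i j => (W * Y * W) i j - if Y i j = 1 then localSize W i + localSize W j - 1 else 0

/-- `N_ij = |C_i| (|C_j| - 1(i = j))`. -/
def pairCount (W : Matrix V V ℝ) : Matrix V V ℝ :=
  fun i j => localSize W i * (localSize W j - if i = j then 1 else 0)

/-- The estimate `S_ij / N_ij` of the connection probability of two local communities. -/
def pairMean (S N : Matrix V V ℝ) (i j : V) : ℝ :=
  S i j / N i j

/-- The pooled estimate `(S_ii + 2 S_ij + S_jj) / (N_ii + 2 N_ij + N_jj)`. -/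
def pooledMean (S N : Matrix V V ℝ) (i j : V) : ℝ :=
  (S i i + 2 * S i j + S j j) / (N i i + 2 * N i j + N j j)

/-- The test statistic `T_ij`. -/
def testStatistic (S N : Matrix V V ℝ) (i j : V) : ℝ :=
  N i i * bernoulliKL (pairMean S N i i) (pooledMean S N i j)
    + N j j * bernoulliKL (pairMean S N j j) (pooledMean S N i j)
    + N i j * bernoulliKL (pairMean S N i j) (pooledMean S N i j)

/-- The updated weights `1(T_ij ≤ lam)`. -/
def updatedWeights (S N : Matrix V V ℝ) (lam : ℝ) : Matrix V V ℝ :=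
  fun i j => if testStatistic S N i j ≤ lam then 1 else 0

/-- Output of the first step of the original algorithm `AWCD°₁`, started at `W = Y`. -/
def awcdOriginal (Y : Matrix V V ℝ) (lam : ℝ) : Matrix V V ℝ :=
  updatedWeights (edgeCount Y Y) (pairCount Y) lam

/-- Output of the first step of the debiased algorithm `AWCD₁`, started at `W = Y`. -/
def awcdDebiased (Y : Matrix V V ℝ) (lam : ℝ) : Matrix V V ℝ :=
  updatedWeights (debiasedEdgeCount Y Y) (pairCount Y) lam

end Algorithm

/-- Consistent exact recovery of the partition along `SBM(n, K, θ n, ρ n)`: for a suitable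
deterministic threshold (which may depend on `n` and the parameters), the probability that
the output `W` of the algorithm satisfies `W i j = W* i j` for all `i`, `j` tends to `1`. -/
def ConsistentExactRecovery (K : ℕ) (θ ρ : ℕ → I)
    (alg : ∀ n : ℕ, Matrix (Vertex K n) (Vertex K n) ℝ → ℝ →
      Matrix (Vertex K n) (Vertex K n) ℝ) : Prop :=
  ∃ lam : ℕ → ℝ,
    Tendsto (fun n : ℕ => sbmMeasure K n (θ n) (ρ n)
      {ω | ∀ i j, alg n (adjacency ω) (lam n) i j = trueWeights K n i j}) atTop (𝓝 1)

end

/-! Write `g = θ - ρ`, `r = Kρ + g`, `D = n r`. Up to degenerate terms, `S_ij` counts the walks `i,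
k, l, j` with `k` a neighbour of `i` and `l` a neighbour of `j`, so `S_ij / N_ij` estimates the
probability that random neighbours of `i` and of `j` are joined. These neighbours fall in the same
community with a probability that depends only on whether `i` and `j` do, and the two resulting
values of the estimate differ by `Δ = g³ / r²`. This is the signal, of order `g³ / θ²` for fixed
`K`.

The correction in `debiasedEdgeCount` removes exactly the walks through the edge `ij`. What remains
(`IsAdj.debiasedEdgeCount_eq`) is a sum of indicators of edges `kl` avoiding `i` and `j`, with
weights that depend only on edges at `i` or `j`. Conditionally on the latter it is a sum of
independent variables, and `predictable_chernoff` applies although the number of terms is random.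

All errors are measured by one noise level `u`. Community counts of neighbourhoods are accurate to
`O(nu)` if `θ log n ≤ n u²`; the remaining edge sum is accurate to `O(D² u)` if `log n ≤ θ n² u²`;
without the correction there is a bias that is harmless if `1 ≤ nθu`. Then every estimate lies
within `ε = O(u)` of its ideal value (`pairMean_close`), outside an event of probability `O(n⁻²)`.

Inside a community the test statistic is at most of order `D² ε² / θ`, by the chi-square bound on
the divergence; across communities it is at least of order `D² Δ² / θ`, by the Hellinger bound. If
`ε` is a small multiple of `Δ`, a threshold separates the two (`updatedWeights_eq_of_close`).
Choosing `u` as a small multiple of `g³ / θ²` turns the three noise conditions into the stated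
rates. -/

noncomputable section

/-! Exponential concentration for Bernoulli sums with predictable weights. -/

/-- The law of independent Bernoulli variables with means `p e`. -/
def bernoulliPi {ι : Type*} [Fintype ι] (p : ι → I) : Measure (ι → Bool) :=
  Measure.pi fun e => bernoulliMeasure true false (p e)

instance bernoulliPi_isProbabilityMeasure {ι : Type*} [Fintype ι] (p : ι → I) :
    IsProbabilityMeasure (bernoulliPi p) := by
  unfold bernoulliPi
  infer_instance

/-- The numerical value of a Boolean. -/
def bit (b : Bool) : ℝ := if b = true then 1 else 0

/-- From `exp z ≤ 1 + z + z²` for `|z| ≤ 1`: the linear terms cancel in the mean, the quadratic one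
is `y² p (1 - p) ≤ y² p`, and `1 + x ≤ exp x`. -/
theorem bernoulli_mgf_le (p : I) {y : ℝ} (hy : |y| ≤ 1) :
    ∫ b, Real.exp (y * (bit b - p) - y ^ 2 * p) ∂(bernoulliMeasure true false p) ≤ 1 := by
  rw [integral_bernoulliMeasure]
  obtain ⟨q, h0, h1⟩ := p
  simp only [bit, if_true, smul_eq_mul, Bool.false_eq_true, if_false]
  have key : ∀ z : ℝ, |z| ≤ 1 → Real.exp z ≤ 1 + z + z ^ 2 := fun z hz => by
    have := (abs_le.1 (Real.abs_exp_sub_one_sub_id_le hz)).2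
    linarith
  have ha : |y * (1 - q)| ≤ 1 := by
    rw [abs_mul, abs_of_nonneg (by linarith : (0 : ℝ) ≤ 1 - q)]
    nlinarith [abs_nonneg y]
  have hb : |y * (0 - q)| ≤ 1 := by
    rw [abs_mul, zero_sub, abs_neg, abs_of_nonneg h0]
    nlinarith [abs_nonneg y]
  have e1 := key _ ha
  have e2 := key _ hb
  have e3 : 1 + y ^ 2 * q ≤ Real.exp (y ^ 2 * q) := by
    linarith [Real.add_one_le_exp (y ^ 2 * q)]
  rw [Real.exp_sub, Real.exp_sub]
  have hpos := Real.exp_pos (y ^ 2 * q)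
  rw [← mul_div_assoc, ← mul_div_assoc, ← add_div, div_le_one hpos]
  refine le_trans ?_ e3
  have h3 : q * Real.exp (y * (1 - q)) ≤ q * (1 + y * (1 - q) + (y * (1 - q)) ^ 2) :=
    mul_le_mul_of_nonneg_left e1 h0
  have h4 : (1 - q) * Real.exp (y * (0 - q)) ≤
      (1 - q) * (1 + y * (0 - q) + (y * (0 - q)) ^ 2) :=
    mul_le_mul_of_nonneg_left e2 (by linarith)
  nlinarith [mul_nonneg (sq_nonneg y) (mul_nonneg h0 h0)]

variable {ι : Type*} [Fintype ι] [DecidableEq ι]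

/-- Conditioning on the coordinates in `F` freezes the weights. The integrand is then a product over
the other coordinates, each factor having mean at most `1` by `bernoulli_mgf_le`. -/
theorem integral_exp_predictable_le_one (p : ι → I) (F : Finset ι)
    (w : (ι → Bool) → ι → ℝ)
    (hdep : ∀ ω ω' : ι → Bool, (∀ e ∈ F, ω e = ω' e) → w ω = w ω')
    (hzero : ∀ ω, ∀ e ∈ F, w ω e = 0) (hle : ∀ ω e, |w ω e| ≤ 1) :
    ∫ ω, Real.exp (∑ e, (w ω e * (bit (ω e) - p e) - w ω e ^ 2 * p e)) ∂(bernoulliPi p) ≤ 1 := by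
  classical
  -- One representative for each configuration on `F`, extended by `false`, so that conditioning
  -- becomes a finite sum over disjoint events.
  set G : Finset (ι → Bool) := Finset.univ.filter fun η => ∀ e ∉ F, η e = false with hG
  have part : ∀ (f : (ι → Bool) → ℝ) (ω : ι → Bool),
      f ω = ∑ η ∈ G, (if ∀ e ∈ F, ω e = η e then f ω else 0) := by
    intro f ω
    rw [Finset.sum_eq_single (fun e => if e ∈ F then ω e else false)]
    · rw [if_pos]; intro e he; simp [he]
    · intro η hη hne
      rw [if_neg]
      intro h
      apply hne
      ext e
      by_cases he : e ∈ F
      · simp [he, h e he]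
      · simp [he, (Finset.mem_filter.1 hη).2 e he]
    · intro h
      exfalso
      apply h
      simp only [hG, Finset.mem_filter, Finset.mem_univ, true_and]
      intro e he
      simp [he]
  have hprod : ∀ (η : ι → Bool) (k : ι → Bool → ℝ) (ω : ι → Bool),
      (∏ e, (if e ∈ F then (if ω e = η e then (1 : ℝ) else 0) else k e (ω e)))
        = if ∀ e ∈ F, ω e = η e then ∏ e, (if e ∈ F then 1 else k e (ω e)) else 0 := by
    intro η k ω
    split_ifs with h
    · apply Finset.prod_congr rfl
      intro e _
      by_cases he : e ∈ F
      · simp [he, h e he]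
      · simp [he]
    · push Not at h
      obtain ⟨e, he, hne⟩ := h
      apply Finset.prod_eq_zero (Finset.mem_univ e)
      simp [he, hne]
  set f : (ι → Bool) → ℝ := fun ω =>
    Real.exp (∑ e, (w ω e * (bit (ω e) - p e) - w ω e ^ 2 * p e)) with hf
  have hfη : ∀ η ω : ι → Bool, (if ∀ e ∈ F, ω e = η e then f ω else 0) =
      ∏ e, (if e ∈ F then (if ω e = η e then (1 : ℝ) else 0) else
        Real.exp (w η e * (bit (ω e) - p e) - w η e ^ 2 * p e)) := by
    intro η ω
    rw [hprod η (fun e b => Real.exp (w η e * (bit b - p e) - w η e ^ 2 * p e)) ω]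
    split_ifs with h
    · simp only [hf, Real.exp_sum]
      apply Finset.prod_congr rfl
      intro e _
      rw [hdep ω η h]
      by_cases he : e ∈ F
      · simp [he, hzero η e he]
      · simp [he]
    · rfl
  have h1η : ∀ η ω : ι → Bool, (if ∀ e ∈ F, ω e = η e then (1 : ℝ) else 0) =
      ∏ e, (if e ∈ F then (if ω e = η e then (1 : ℝ) else 0) else 1) := by
    intro η ω
    rw [hprod η (fun _ _ => 1) ω]
    simp
  -- On each event, both the integrand and the indicator factor over coordinates, and they are
  -- compared factor by factor.
  have hcmp : ∀ η : ι → Bool, ∫ ω, (if ∀ e ∈ F, ω e = η e then f ω else 0) ∂(bernoulliPi p) ≤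
      ∫ ω, (if ∀ e ∈ F, ω e = η e then (1 : ℝ) else 0) ∂(bernoulliPi p) := by
    intro η
    simp only [hfη, h1η]
    unfold bernoulliPi
    rw [integral_fintype_prod_eq_prod (fun e b => if e ∈ F then (if b = η e then (1 : ℝ) else 0)
        else Real.exp (w η e * (bit b - p e) - w η e ^ 2 * p e)),
      integral_fintype_prod_eq_prod (fun e b => if e ∈ F then (if b = η e then (1 : ℝ) else 0)
        else 1)]
    apply Finset.prod_le_prod
    · intro e _
      apply integral_nonneg
      intro b
      dsimp only [Pi.zero_apply]
      split_ifs <;> positivity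
    · intro e _
      by_cases he : e ∈ F
      · simp [he]
      · simp only [he, if_false]
        simpa using bernoulli_mgf_le (p e) (hle η e)
  have e1 : ∫ ω, f ω ∂(bernoulliPi p) =
      ∑ η ∈ G, ∫ ω, (if ∀ e ∈ F, ω e = η e then f ω else 0) ∂(bernoulliPi p) := by
    rw [← integral_finsetSum _ (fun _ _ => Integrable.of_finite)]
    exact integral_congr_ae (Eventually.of_forall fun ω => part f ω)
  have e2 : (1 : ℝ) =
      ∑ η ∈ G, ∫ ω, (if ∀ e ∈ F, ω e = η e then (1 : ℝ) else 0) ∂(bernoulliPi p) := by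
    rw [← integral_finsetSum _ (fun _ _ => Integrable.of_finite)]
    rw [← integral_congr_ae (Eventually.of_forall fun ω => part (fun _ => 1) ω)]
    simp
  calc _ = ∫ ω, f ω ∂(bernoulliPi p) := rfl
    _ ≤ 1 := by
      rw [e1]
      conv_rhs => rw [e2]
      exact Finset.sum_le_sum fun η _ => hcmp η

/-- Chernoff bound for a Bernoulli sum whose `0`-`1` weights are determined by the coordinates
in `F` and vanish on these coordinates. -/
theorem predictable_chernoff {X : Type*} [Fintype X] (p : ι → I) (F : Finset ι) (φ : X → ι)
    (hφ : ∀ e, (Finset.univ.filter fun x => φ x = e).card ≤ 2)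
    (c : (ι → Bool) → X → ℝ) (hc0 : ∀ ω x, 0 ≤ c ω x) (hc1 : ∀ ω x, c ω x ≤ 1)
    (hdep : ∀ ω ω' : ι → Bool, (∀ e ∈ F, ω e = ω' e) → c ω = c ω')
    (hzero : ∀ ω x, φ x ∈ F → c ω x = 0) {s : ℝ} (hs0 : 0 ≤ s) (hs : s ≤ 1 / 2) (v t : ℝ) :
    (bernoulliPi p).real {ω | ∑ x, c ω x * p (φ x) ≤ v ∧
      t ≤ |∑ x, c ω x * (bit (ω (φ x)) - p (φ x))|} ≤ 2 * Real.exp (-(s * t) + 2 * s ^ 2 * v) := by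
  -- Several indices may use the same coordinate, as `(k, l)` and `(l, k)` do for an edge. Fibre
  -- sums give weights in `[0, 2]`, which is why `s ≤ 1/2` is needed.
  set w : (ι → Bool) → ι → ℝ := fun ω e => ∑ x ∈ Finset.univ.filter (fun x => φ x = e), c ω x
    with hw
  have hw0 : ∀ ω e, 0 ≤ w ω e := fun ω e => Finset.sum_nonneg fun x _ => hc0 ω x
  have hw2 : ∀ ω e, w ω e ≤ 2 := fun ω e => by
    calc w ω e ≤ ∑ x ∈ Finset.univ.filter (fun x => φ x = e), (1 : ℝ) :=
          Finset.sum_le_sum fun x _ => hc1 ω x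
      _ ≤ 2 := by simpa using (by exact_mod_cast hφ e)
  have hfib : ∀ ω (g : ι → ℝ), ∑ x, c ω x * g (φ x) = ∑ e, w ω e * g e := by
    intro ω g
    rw [← Finset.sum_fiberwise Finset.univ φ]
    apply Finset.sum_congr rfl
    intro e _
    rw [hw, Finset.sum_mul]
    apply Finset.sum_congr rfl
    intro x hx
    rw [(Finset.mem_filter.1 hx).2]
  have one_side : ∀ r : ℝ, |r| ≤ 1 / 2 → (bernoulliPi p).real {ω | ∑ x, c ω x * p (φ x) ≤ v ∧
      |r| * t ≤ r * ∑ x, c ω x * (bit (ω (φ x)) - p (φ x))} ≤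
      Real.exp (-(|r| * t) + 2 * r ^ 2 * v) := by
    intro r hr
    have hI := integral_exp_predictable_le_one p F (fun ω e => r * w ω e)
      (fun ω ω' h => by simp only [hw, hdep ω ω' h])
      (fun ω e he => by
        simp only [hw]
        rw [Finset.sum_eq_zero, mul_zero]
        intro x hx
        exact hzero ω x (by rw [(Finset.mem_filter.1 hx).2]; exact he))
      (fun ω e => by
        rw [abs_mul, abs_of_nonneg (hw0 ω e)]
        nlinarith [abs_nonneg r, hw0 ω e, hw2 ω e])
    have hM := mul_meas_ge_le_integral_of_nonneg (μ := bernoulliPi p)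
      (f := fun ω => Real.exp (∑ e, (r * w ω e * (bit (ω e) - p e) - (r * w ω e) ^ 2 * p e)))
      (Eventually.of_forall fun ω => (Real.exp_pos _).le) Integrable.of_finite
      (Real.exp (|r| * t - 2 * r ^ 2 * v))
    have hsub : {ω | ∑ x, c ω x * p (φ x) ≤ v ∧
        |r| * t ≤ r * ∑ x, c ω x * (bit (ω (φ x)) - p (φ x))} ⊆
        {ω | Real.exp (|r| * t - 2 * r ^ 2 * v) ≤
          Real.exp (∑ e, (r * w ω e * (bit (ω e) - p e) - (r * w ω e) ^ 2 * p e))} := by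
      rintro ω ⟨h1, h2⟩
      simp only [Set.mem_ofPred_eq, Real.exp_le_exp]
      rw [hfib ω (fun e => p e)] at h1
      rw [hfib ω (fun e => bit (ω e) - p e)] at h2
      -- Here `w² ≤ 2 w`. The random compensator is controlled only where the variance proxy is at
      -- most `v`, hence the intersection in the event.
      have h3 : ∑ e, (r * w ω e) ^ 2 * (p e : ℝ) ≤ 2 * r ^ 2 * v := by
        calc ∑ e, (r * w ω e) ^ 2 * (p e : ℝ) ≤ ∑ e, 2 * r ^ 2 * (w ω e * p e) := by
              apply Finset.sum_le_sum
              intro e _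
              have hp : (0 : ℝ) ≤ p e := (p e).2.1
              have := mul_nonneg (mul_nonneg (sq_nonneg r) hp)
                (mul_nonneg (hw0 ω e) (sub_nonneg.2 (hw2 ω e)))
              nlinarith
          _ = 2 * r ^ 2 * ∑ e, w ω e * p e := by rw [Finset.mul_sum]
          _ ≤ 2 * r ^ 2 * v := by gcongr
      rw [Finset.sum_sub_distrib]
      have h4 : ∑ e, r * w ω e * (bit (ω e) - p e) = r * ∑ e, w ω e * (bit (ω e) - p e) := by
        rw [Finset.mul_sum]; exact Finset.sum_congr rfl fun _ _ => by ring
      rw [h4]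
      linarith
    have h5 := measureReal_mono (μ := bernoulliPi p) hsub
    have h6 := hM.trans hI
    rw [← le_div_iff₀' (Real.exp_pos _), one_div, ← Real.exp_neg] at h6
    refine h5.trans (h6.trans (le_of_eq ?_))
    congr 1
    ring
  have hA := one_side s (by rwa [abs_of_nonneg hs0])
  have hB := one_side (-s) (by rwa [abs_neg, abs_of_nonneg hs0])
  rw [abs_neg] at hB
  rw [abs_of_nonneg hs0] at hA hB
  rw [neg_sq] at hB
  have hsub : {ω | ∑ x, c ω x * p (φ x) ≤ v ∧
      t ≤ |∑ x, c ω x * (bit (ω (φ x)) - p (φ x))|} ⊆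
      {ω | ∑ x, c ω x * p (φ x) ≤ v ∧ s * t ≤ s * ∑ x, c ω x * (bit (ω (φ x)) - p (φ x))} ∪
      {ω | ∑ x, c ω x * p (φ x) ≤ v ∧ s * t ≤ -s * ∑ x, c ω x * (bit (ω (φ x)) - p (φ x))} := by
    rintro ω ⟨h1, h2⟩
    rcases le_abs.1 h2 with h | h
    · exact Or.inl ⟨h1, mul_le_mul_of_nonneg_left h hs0⟩
    · exact Or.inr ⟨h1, by rw [neg_mul, ← mul_neg]; exact mul_le_mul_of_nonneg_left h hs0⟩
  have := (measureReal_mono (μ := bernoulliPi p) hsub).trans (measureReal_union_le _ _)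
  linarith

end

noncomputable section

/-! Separation of the test statistics. -/

theorem bernoulliKL_le_chiSq {p q : ℝ} (hp0 : 0 < p) (hp1 : p < 1) (hq0 : 0 < q) (hq1 : q < 1) :
    bernoulliKL p q ≤ (p - q) ^ 2 / (q * (1 - q)) := by
  have h1 : 0 < 1 - p := by linarith
  have h2 : 0 < 1 - q := by linarith
  have e1 := Real.log_le_sub_one_of_pos (div_pos hp0 hq0)
  have e2 := Real.log_le_sub_one_of_pos (div_pos h1 h2)
  unfold bernoulliKL
  calc _ ≤ p * (p / q - 1) + (1 - p) * ((1 - p) / (1 - q) - 1) := by gcongr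
    _ = _ := by field_simp; ring

/-- Applying `log z ≤ z - 1` to `z = √y / √x` bounds the divergence below by the squared Hellinger
distance, and `(√p + √q)² ≤ 2 (p + q)`. -/
theorem hellinger_le_bernoulliKL {p q : ℝ} (hp0 : 0 < p) (hp1 : p < 1) (hq0 : 0 < q)
    (hq1 : q < 1) : (p - q) ^ 2 / (2 * (p + q)) ≤ bernoulliKL p q := by
  have key : ∀ x y : ℝ, 0 < x → 0 < y → 2 * x - 2 * (√x * √y) ≤ x * Real.log (x / y) := by
    intro x y hx hy
    have hsx := Real.sqrt_pos.2 hx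
    have hsy := Real.sqrt_pos.2 hy
    have h := Real.log_le_sub_one_of_pos (div_pos hsy hsx)
    have h2 : Real.log (x / y) = -(2 * Real.log (√y / √x)) := by
      rw [Real.log_div hx.ne' hy.ne', Real.log_div hsy.ne' hsx.ne', Real.log_sqrt hx.le,
        Real.log_sqrt hy.le]
      ring
    have h3 : x * (√y / √x) = √x * √y := by
      nth_rewrite 1 [← Real.mul_self_sqrt hx.le]
      field_simp
    rw [h2]
    nlinarith
  have k1 := key p q hp0 hq0
  have k2 := key (1 - p) (1 - q) (by linarith) (by linarith)
  have hp := Real.mul_self_sqrt hp0.le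
  have hq := Real.mul_self_sqrt hq0.le
  have hp' := Real.mul_self_sqrt (show 0 ≤ 1 - p by linarith)
  have hq' := Real.mul_self_sqrt (show 0 ≤ 1 - q by linarith)
  unfold bernoulliKL
  rw [div_le_iff₀ (by positivity)]
  have h1 : (√p - √q) ^ 2 ≤ p * Real.log (p / q) + (1 - p) * Real.log ((1 - p) / (1 - q)) := by
    nlinarith [sq_nonneg (√(1 - p) - √(1 - q))]
  have h2 : (p - q) ^ 2 = (√p - √q) ^ 2 * (√p + √q) ^ 2 := by
    nth_rewrite 1 [← hp, ← hq]
    ring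
  rw [h2]
  have h3 : (√p + √q) ^ 2 ≤ 2 * (p + q) := by nlinarith [sq_nonneg (√p - √q)]
  calc _ ≤ (√p - √q) ^ 2 * (2 * (p + q)) := by gcongr
    _ ≤ _ := by gcongr

theorem bernoulliKL_nonneg {p q : ℝ} (hp0 : 0 < p) (hp1 : p < 1) (hq0 : 0 < q)
    (hq1 : q < 1) : 0 ≤ bernoulliKL p q :=
  le_trans (by positivity) (hellinger_le_bernoulliKL hp0 hp1 hq0 hq1)

theorem weightedMean_mem {s₁ s₂ s₃ n₁ n₂ n₃ a b : ℝ} (h₁ : 0 < n₁) (h₂ : 0 < n₂) (h₃ : 0 < n₃)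
    (b₁ : a ≤ s₁ / n₁ ∧ s₁ / n₁ ≤ b) (b₂ : a ≤ s₂ / n₂ ∧ s₂ / n₂ ≤ b)
    (b₃ : a ≤ s₃ / n₃ ∧ s₃ / n₃ ≤ b) :
    a ≤ (s₁ + 2 * s₂ + s₃) / (n₁ + 2 * n₂ + n₃) ∧
      (s₁ + 2 * s₂ + s₃) / (n₁ + 2 * n₂ + n₃) ≤ b := by
  rw [le_div_iff₀ h₁, div_le_iff₀ h₁] at b₁
  rw [le_div_iff₀ h₂, div_le_iff₀ h₂] at b₂
  rw [le_div_iff₀ h₃, div_le_iff₀ h₃] at b₃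
  rw [le_div_iff₀ (by positivity), div_le_iff₀ (by positivity)]
  constructor <;> nlinarith

/-- If the estimates `S / N` are within `ε` of the value `t` inside the communities and of
`t - Δ` between them, with `ε` small compared to `Δ`, then a threshold recovers the partition. -/
theorem updatedWeights_eq_of_close {V κ : Type*} [DecidableEq κ] (cl : V → κ)
    (S N : Matrix V V ℝ) {C D t Δ ε θ : ℝ} (hC : 1 ≤ C) (hD : 0 < D) (hθ0 : 0 < θ)
    (hθ : θ ≤ 1 / 2) (ht : t ≤ θ) (htΔ : θ ≤ C * (t - Δ)) (hε0 : 0 ≤ ε)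
    (hε : 600 * C * ε < Δ)
    (hN0 : ∀ i j, D ^ 2 / 8 ≤ N i j) (hN1 : ∀ i j, N i j ≤ 4 * D ^ 2)
    (hS : ∀ i j, |pairMean S N i j - (if cl i = cl j then t else t - Δ)| ≤ ε) (i j : V) :
    updatedWeights S N (384 * C * D ^ 2 * ε ^ 2 / θ) i j = if cl i = cl j then 1 else 0 := by
  have hNpos : ∀ i j, 0 < N i j := fun i j => lt_of_lt_of_le (by positivity) (hN0 i j)
  have hΔ : 0 < Δ := lt_of_le_of_lt (by positivity) hε
  have hΔ2 : 600 * ε < Δ := by nlinarith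
  have hq : 0 < t - Δ := by
    by_contra h
    nlinarith
  have hε3 : ε ≤ (t - Δ) / 2 := by
    have h1 : Δ ≤ θ := by linarith
    have h2 : C * (600 * ε) ≤ C * (t - Δ) := by nlinarith
    have := le_of_mul_le_mul_left h2 (by linarith)
    linarith
  have hε4 : ε ≤ θ / 2 := by linarith
  have e1 := abs_le.1 (hS i i)
  have e2 := abs_le.1 (hS j j)
  have e3 := abs_le.1 (hS i j)
  simp only [if_true] at e1 e2
  have hlow : θ / (2 * C) ≤ t - Δ - ε := by
    rw [div_le_iff₀ (by positivity)]
    nlinarith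
  have hlow0 : 0 < θ / (2 * C) := by positivity
  unfold updatedWeights
  by_cases h : cl i = cl j
  · rw [if_pos h] at e3 ⊢
    have m1 : t - ε ≤ pairMean S N i i ∧ pairMean S N i i ≤ t + ε :=
      ⟨by linarith, by linarith⟩
    have m2 : t - ε ≤ pairMean S N i j ∧ pairMean S N i j ≤ t + ε :=
      ⟨by linarith, by linarith⟩
    have m3 : t - ε ≤ pairMean S N j j ∧ pairMean S N j j ≤ t + ε :=
      ⟨by linarith, by linarith⟩
    have hm : t - ε ≤ pooledMean S N i j ∧ pooledMean S N i j ≤ t + ε :=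
      weightedMean_mem (hNpos i i) (hNpos i j) (hNpos j j) m1 m2 m3
    rw [if_pos]
    -- The pooled mean `q` also lies within `ε` of `t`, so the numerator is at most `(2ε)²`, while
    -- `q (1 - q) ≥ θ / (8C)` and `N ≤ 4D²`. Three such terms make up the threshold, `384 = 3 *
    -- 128`.
    have key : ∀ k l, t - ε ≤ pairMean S N k l → pairMean S N k l ≤ t + ε →
        N k l * bernoulliKL (pairMean S N k l) (pooledMean S N i j) ≤
          128 * C * D ^ 2 * ε ^ 2 / θ := by
      intro k l h1 h2
      have hkl := bernoulliKL_le_chiSq (p := pairMean S N k l) (q := pooledMean S N i j)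
        (by linarith) (by linarith)
        (by linarith) (by linarith)
      have hq1 : θ / (2 * C) ≤ pooledMean S N i j := by linarith
      have hq2 : 1 / 4 ≤ 1 - pooledMean S N i j := by linarith
      have hq0 : 0 ≤ pooledMean S N i j := hlow0.le.trans hq1
      have hden : θ / (8 * C) ≤ pooledMean S N i j * (1 - pooledMean S N i j) := by
        calc θ / (8 * C) = θ / (2 * C) * (1 / 4) := by field_simp; norm_num
          _ ≤ _ := by gcongr
      have hnum : (pairMean S N k l - pooledMean S N i j) ^ 2 ≤ (2 * ε) ^ 2 := by
        apply sq_le_sq'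
        · linarith
        · linarith
      calc _ ≤ 4 * D ^ 2 * ((2 * ε) ^ 2 / (θ / (8 * C))) := by
            apply mul_le_mul (hN1 k l) _ _ (by positivity)
            · exact hkl.trans (by gcongr)
            · apply bernoulliKL_nonneg <;> linarith
        _ = _ := by field_simp; ring
    have k1 := key i i (by linarith) (by linarith)
    have k2 := key j j (by linarith) (by linarith)
    have k3 := key i j (by linarith) (by linarith)
    unfold testStatistic
    calc _ ≤ 128 * C * D ^ 2 * ε ^ 2 / θ + 128 * C * D ^ 2 * ε ^ 2 / θ
          + 128 * C * D ^ 2 * ε ^ 2 / θ := by gcongr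
      _ = _ := by ring
  · rw [if_neg h] at e3 ⊢
    have m1 : t - Δ - ε ≤ pairMean S N i i ∧ pairMean S N i i ≤ t + ε :=
      ⟨by linarith, by linarith⟩
    have m2 : t - Δ - ε ≤ pairMean S N i j ∧ pairMean S N i j ≤ t + ε :=
      ⟨by linarith, by linarith⟩
    have m3 : t - Δ - ε ≤ pairMean S N j j ∧ pairMean S N j j ≤ t + ε :=
      ⟨by linarith, by linarith⟩
    have hm : t - Δ - ε ≤ pooledMean S N i j ∧ pooledMean S N i j ≤ t + ε :=
      weightedMean_mem (hNpos i i) (hNpos i j) (hNpos j j) m1 m2 m3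
    rw [if_neg]
    rw [not_le]
    have nn : ∀ k l, t - Δ - ε ≤ pairMean S N k l → pairMean S N k l ≤ t + ε →
        0 ≤ N k l * bernoulliKL (pairMean S N k l) (pooledMean S N i j) := by
      intro k l h1 h2
      apply mul_nonneg (hNpos k l).le
      apply bernoulliKL_nonneg <;> linarith
    have key : ∀ k l, t - Δ - ε ≤ pairMean S N k l → pairMean S N k l ≤ t + ε →
        (Δ / 4) ^ 2 ≤ (pairMean S N k l - pooledMean S N i j) ^ 2 →
        384 * C * D ^ 2 * ε ^ 2 / θ <
        N k l * bernoulliKL (pairMean S N k l) (pooledMean S N i j) := by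
      intro k l h1 h2 h3
      have hkl := hellinger_le_bernoulliKL (p := pairMean S N k l) (q := pooledMean S N i j)
        (by linarith) (by linarith)
        (by linarith) (by linarith)
      have hden : 2 * (pairMean S N k l + pooledMean S N i j) ≤ 6 * θ := by
        linarith
      have hpos : 0 < 2 * (pairMean S N k l + pooledMean S N i j) := by
        linarith
      -- The constant `600` is chosen so that `384 * 768 = 294912 < 600²`.
      have hlt : 384 * C * D ^ 2 * ε ^ 2 / θ < D ^ 2 / 8 * ((Δ / 4) ^ 2 / (6 * θ)) := by
        have h5 : (600 * C * ε) ^ 2 < Δ ^ 2 := by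
          apply sq_lt_sq' _ hε
          have : 0 ≤ 600 * C * ε := by positivity
          linarith
        have h6 : 294912 * C * ε ^ 2 < Δ ^ 2 := by
          have : C * ε ^ 2 ≤ C ^ 2 * ε ^ 2 := by
            apply mul_le_mul_of_nonneg_right _ (sq_nonneg ε)
            nlinarith
          have h7 : 0 ≤ C * ε ^ 2 := by positivity
          nlinarith
        have h8 : D ^ 2 / 8 * ((Δ / 4) ^ 2 / (6 * θ)) = D ^ 2 * Δ ^ 2 / 768 / θ := by
          field_simp; norm_num
        rw [h8]
        apply div_lt_div_of_pos_right _ hθ0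
        have : 0 < D ^ 2 := by positivity
        nlinarith
      refine hlt.trans_le ?_
      apply mul_le_mul (hN0 k l) _ (by positivity) (hNpos k l).le
      refine le_trans ?_ hkl
      calc (Δ / 4) ^ 2 / (6 * θ) ≤ (Δ / 4) ^ 2 / (2 * (pairMean S N k l + pooledMean S N i j)) := by
            gcongr
        _ ≤ _ := by
          apply div_le_div_of_nonneg_right h3 hpos.le
    have n1 := nn i i (by linarith) (by linarith)
    have n2 := nn j j (by linarith) (by linarith)
    have n3 := nn i j (by linarith) (by linarith)
    unfold testStatistic
    -- The pooled mean cannot be near both `t` and `t - Δ`: on either side of the midpoint, one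
    -- estimate is at distance at least `Δ / 2 - ε ≥ Δ / 4` from it.
    rcases le_total (pooledMean S N i j) (t - Δ / 2) with hc | hc
    · have := key i i (by linarith) (by linarith)
        (by apply pow_le_pow_left₀ (by positivity); linarith)
      linarith
    · have := key i j (by linarith) (by linarith)
        (by rw [← neg_sq (pairMean S N i j - _)]; apply pow_le_pow_left₀ (by positivity); linarith)
      linarith

end

noncomputable section

/-! Deterministic estimates for the edge counts of a graph with regular neighbourhoods. -/

section Graph

variable {V : Type*}

/-- Symmetric `0`-`1` matrices with zero diagonal. -/
structure IsAdj (Y : Matrix V V ℝ) : Prop where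
  zero_or_one : ∀ i j, Y i j = 0 ∨ Y i j = 1
  symm : ∀ i j, Y i j = Y j i
  diag : ∀ i, Y i i = 0

variable {Y : Matrix V V ℝ}

theorem IsAdj.nonneg (hY : IsAdj Y) (i j : V) : 0 ≤ Y i j := by
  rcases hY.zero_or_one i j with h | h <;> simp [h]

theorem IsAdj.le_one (hY : IsAdj Y) (i j : V) : Y i j ≤ 1 := by
  rcases hY.zero_or_one i j with h | h <;> simp [h]

/-- The indicator that `k` is a neighbour of `i` and `l` a neighbour of `j`,
where `k ≠ l` and both differ from `i` and `j`. -/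
def spread [DecidableEq V] (Y : Matrix V V ℝ) (i j : V) (x : V × V) : ℝ :=
  if (x.1 ≠ i ∧ x.1 ≠ j) ∧ (x.2 ≠ i ∧ x.2 ≠ j) ∧ x.1 ≠ x.2 then Y i x.1 * Y j x.2 else 0

theorem IsAdj.spread_nonneg [DecidableEq V] (hY : IsAdj Y) (i j : V) (x : V × V) : 0 ≤ spread Y i j x := by
  unfold spread
  split_ifs
  · exact mul_nonneg (hY.nonneg _ _) (hY.nonneg _ _)
  · exact le_rfl

theorem IsAdj.spread_le [DecidableEq V] (hY : IsAdj Y) (i j : V) (x : V × V) :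
    spread Y i j x ≤ Y i x.1 * Y j x.2 := by
  unfold spread
  split_ifs
  · exact le_rfl
  · exact mul_nonneg (hY.nonneg _ _) (hY.nonneg _ _)

variable [Fintype V]

theorem IsAdj.localSize_eq (hY : IsAdj Y) (i : V) : localSize Y i = ∑ k, Y i k := by
  unfold localSize
  rw [Finset.card_filter]
  push_cast
  apply Finset.sum_congr rfl
  intro k _
  rcases hY.zero_or_one i k with h | h <;> simp [h]

theorem IsAdj.localSize_nonneg (hY : IsAdj Y) (i : V) : 0 ≤ localSize Y i := by
  rw [hY.localSize_eq]
  exact Finset.sum_nonneg fun k _ => hY.nonneg i k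

theorem sum_mul_row (Y : Matrix V V ℝ) (i j : V) :
    ∑ x : V × V, Y i x.1 * Y j x.2 = (∑ k, Y i k) * ∑ l, Y j l := by
  rw [Fintype.sum_prod_type, Finset.sum_mul_sum]

variable [DecidableEq V]

/-- A walk `i, k, l, j` that is not spread has `k = j` or `l = i`, since the diagonal vanishes. Such
walks exist only if `ij` is an edge, and inclusion–exclusion counts them as `|C_i| + |C_j| - 1`. -/
theorem IsAdj.debiasedEdgeCount_eq (hY : IsAdj Y) (i j : V) :
    debiasedEdgeCount Y Y i j = ∑ x : V × V, spread Y i j x * Y x.1 x.2 := by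
  have hpt : ∀ k l, Y i k * Y k l * Y l j = spread Y i j (k, l) * Y k l +
      Y i j * ((if k = j then Y j l else 0) + (if l = i then Y i k else 0) -
        (if k = j then (if l = i then 1 else 0) else 0)) := by
    intro k l
    unfold spread
    rw [hY.symm l j]
    have hid : ∀ a b, Y a b * Y a b = Y a b := fun a b => by
      rcases hY.zero_or_one a b with h | h <;> simp [h]
    by_cases hkl : k = l
    · subst hkl
      by_cases h1 : k = j
      · subst h1
        by_cases h2 : k = i
        · subst h2; simp [hY.diag]
        · simp [hY.diag, h2]
      · by_cases h2 : k = i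
        · subst h2; simp [hY.diag, h1]
        · simp [hY.diag, h1, h2]
    by_cases hki : k = i
    · subst hki
      by_cases h1 : k = j
      · subst h1; simp [hY.diag]
      · simp [hY.diag, h1]
    by_cases hlj : l = j
    · subst hlj
      simp only [hY.diag, mul_zero, ne_eq, hkl, not_false_eq_true, and_true,
        if_false, ite_self, zero_mul, zero_add]
      by_cases h1 : l = i
      · subst h1; simp [hY.diag]
      · simp [h1]
    by_cases hkj : k = j
    · subst hkj
      by_cases hli : l = i
      · subst hli
        rw [hY.symm k l]
        simp
        have := hid l k
        rcases hY.zero_or_one l k with h | h <;> simp [h]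
      · rcases hY.zero_or_one k l with h | h <;> simp [hli, h]
    · by_cases hli : l = i
      · subst hli
        rw [hY.symm k l, hid, hY.symm j l]
        simp [hkj]
        ring
      · simp [hkl, hki, hlj, hkj, hli]
        ring
  have hsum : (Y * Y * Y) i j = ∑ x : V × V, spread Y i j x * Y x.1 x.2 +
      Y i j * (localSize Y i + localSize Y j - 1) := by
    rw [Matrix.mul_apply]
    simp only [Matrix.mul_apply, Finset.sum_mul]
    rw [Finset.sum_comm]
    simp only [hpt, Finset.sum_add_distrib]
    rw [Fintype.sum_prod_type]
    congr 1
    simp only [← Finset.mul_sum, Finset.sum_sub_distrib, Finset.sum_add_distrib]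
    congr 1
    simp only [Finset.sum_ite_eq', Finset.mem_univ, if_true]
    rw [Finset.sum_comm]
    simp only [Finset.sum_ite_eq', Finset.mem_univ, if_true]
    rw [hY.localSize_eq, hY.localSize_eq]
    have : ∑ y : V, (if y = i then (1 : ℝ) else 0) = 1 := by simp
    rw [Finset.sum_comm]
    simp only [Finset.sum_ite_eq', Finset.mem_univ, if_true]
    ring
  unfold debiasedEdgeCount
  rw [hsum]
  rcases hY.zero_or_one i j with h | h <;> simp [h]

/-- The excluded pairs that contribute have `k = l`, `l = i` or `k = j`. There are at most `|C_i|`,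
`|C_i|` and `|C_j|` of them, and each costs at most `θ`. -/
theorem IsAdj.sum_spread_close (hY : IsAdj Y) (i j : V) (P : V → V → ℝ) {θ : ℝ}
    (hP0 : ∀ k l, 0 ≤ P k l) (hP1 : ∀ k l, P k l ≤ θ) :
    |∑ x : V × V, spread Y i j x * P x.1 x.2 - ∑ x : V × V, Y i x.1 * Y j x.2 * P x.1 x.2| ≤
      θ * (2 * localSize Y i + localSize Y j) := by
  rw [abs_sub_comm, ← Finset.sum_sub_distrib, abs_of_nonneg]
  · have hpt : ∀ k l, Y i k * Y j l * P k l - spread Y i j (k, l) * P k l ≤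
        θ * ((if l = k then Y i k else 0) + (if k = j then Y j l else 0)
          + (if l = i then Y i k else 0)) := by
      intro k l
      have hθ : 0 ≤ θ := (hP0 k l).trans (hP1 k l)
      have hik := hY.nonneg i k
      have hjl := hY.nonneg j l
      have rest : 0 ≤ (if l = k then Y i k else 0) + (if k = j then Y j l else 0)
          + (if l = i then Y i k else 0) := by
        refine add_nonneg (add_nonneg ?_ ?_) ?_ <;> split_ifs <;> first | assumption | exact le_rfl
      unfold spread
      split_ifs with hs
      all_goals simp only [sub_self, zero_mul, sub_zero]
      all_goals try (apply mul_nonneg hθ; positivity)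
      all_goals
        have hb1 : Y i k * Y j l * P k l ≤ θ * Y i k := by
          have := mul_le_mul (mul_le_of_le_one_right hik (hY.le_one j l)) (hP1 k l) (hP0 k l) hik
          linarith
        have hb2 : Y i k * Y j l * P k l ≤ θ * Y j l := by
          have := mul_le_mul (mul_le_of_le_one_left hjl (hY.le_one i k)) (hP1 k l) (hP0 k l) hjl
          linarith
        have hb3 : 0 ≤ θ * Y i k := mul_nonneg hθ hik
        have hb4 : 0 ≤ θ * Y j l := mul_nonneg hθ hjl
        try linarith
      have : k = i ∨ l = j := by tauto
      rcases this with h | h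
      · subst h; simp [hY.diag]
      · subst h; simp [hY.diag]
    calc _ ≤ ∑ x : V × V, θ * ((if x.2 = x.1 then Y i x.1 else 0) + (if x.1 = j then Y j x.2 else 0)
          + (if x.2 = i then Y i x.1 else 0)) := Finset.sum_le_sum fun x _ => hpt x.1 x.2
      _ = _ := by
        rw [← Finset.mul_sum, Fintype.sum_prod_type]
        simp only [Finset.sum_add_distrib, Finset.sum_ite_eq', Finset.mem_univ, if_true]
        rw [Finset.sum_comm (f := fun x y => if x = j then Y j y else 0)]
        simp only [Finset.sum_ite_eq', Finset.mem_univ, if_true]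
        rw [hY.localSize_eq, hY.localSize_eq]
        ring
  · apply Finset.sum_nonneg
    intro x _
    have := mul_le_mul_of_nonneg_right (hY.spread_le i j x) (hP0 x.1 x.2)
    linarith

end Graph

end

/-! ### Neighbourhood profiles of the communities and the values near which the estimates lie. -/

noncomputable section

/-- The connection probability of two communities. -/
def blockProb {K : ℕ} (θ ρ : ℝ) (a b : Fin K) : ℝ := if a = b then θ else ρ

section Block

variable {K : ℕ} {θ ρ : ℝ}

theorem blockProb_eq (a b : Fin K) :
    blockProb θ ρ a b = ρ + (θ - ρ) * (if a = b then 1 else 0) := by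
  unfold blockProb
  split_ifs <;> ring

theorem sum_blockProb (a : Fin K) : ∑ b, blockProb θ ρ a b = K * ρ + (θ - ρ) := by
  simp only [blockProb_eq, Finset.sum_add_distrib, ← Finset.mul_sum]
  simp

theorem sum_blockProb_mul (a b : Fin K) :
    ∑ c, blockProb θ ρ a c * blockProb θ ρ b c =
      K * ρ ^ 2 + 2 * ρ * (θ - ρ) + (θ - ρ) ^ 2 * (if a = b then 1 else 0) := by
  have : ∀ c, blockProb θ ρ a c * blockProb θ ρ b c = ρ ^ 2 +
      ρ * (θ - ρ) * (if a = c then 1 else 0) + ρ * (θ - ρ) * (if b = c then 1 else 0) +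
      (θ - ρ) ^ 2 * (if a = c then (if b = c then 1 else 0) else 0) := by
    intro c
    rw [blockProb_eq, blockProb_eq]
    split_ifs <;> ring
  simp only [this, Finset.sum_add_distrib, ← Finset.mul_sum]
  simp [eq_comm]
  ring

theorem IsAdj.localSize_eq_sum_sum {n : ℕ} {Y : Matrix (Vertex K n) (Vertex K n) ℝ}
    (hY : IsAdj Y) (i : Vertex K n) : localSize Y i = ∑ a, ∑ m, Y i (a, m) := by
  rw [hY.localSize_eq, Fintype.sum_prod_type]

theorem localSize_close {n : ℕ} {η : ℝ} {Y : Matrix (Vertex K n) (Vertex K n) ℝ} (hY : IsAdj Y)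
    (hcnt : ∀ (i : Vertex K n) (a : Fin K), |∑ m, Y i (a, m) - n * blockProb θ ρ i.1 a| ≤ η)
    (i : Vertex K n) : |localSize Y i - n * (K * ρ + (θ - ρ))| ≤ K * η := by
  have : localSize Y i - n * (K * ρ + (θ - ρ)) =
      ∑ a, (∑ m, Y i (a, m) - n * blockProb θ ρ i.1 a) := by
    rw [hY.localSize_eq_sum_sum, Finset.sum_sub_distrib, ← Finset.mul_sum, sum_blockProb]
  rw [this]
  refine (Finset.abs_sum_le_sum_abs _ _).trans ?_
  calc _ ≤ ∑ a : Fin K, η := Finset.sum_le_sum fun a _ => hcnt i a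
    _ = _ := by simp

theorem pairCount_bounds {V : Type*} [Fintype V] [DecidableEq V] {Y : Matrix V V ℝ} {D : ℝ}
    (hD : 4 ≤ D) (hd1 : ∀ i, D / 2 ≤ localSize Y i) (hd2 : ∀ i, localSize Y i ≤ 2 * D) (i j : V) :
    D ^ 2 / 8 ≤ pairCount Y i j ∧ pairCount Y i j ≤ 4 * D ^ 2 ∧
      |localSize Y i * localSize Y j - pairCount Y i j| ≤ 2 * D := by
  unfold pairCount
  have h1 := hd1 i
  have h2 := hd2 i
  have h3 := hd1 j
  have h4 := hd2 j
  split_ifs with h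
  · refine ⟨?_, ?_, ?_⟩
    · have := mul_le_mul h1 (show D / 2 - 1 ≤ localSize Y j - 1 by linarith) (by linarith)
        (by linarith)
      nlinarith
    · have := mul_le_mul h2 (show localSize Y j - 1 ≤ 2 * D by linarith) (by linarith)
        (by linarith)
      nlinarith
    · rw [abs_le]; constructor <;> linarith
  · refine ⟨?_, ?_, ?_⟩
    · have := mul_le_mul h1 h3 (by linarith) (by linarith)
      nlinarith
    · have := mul_le_mul h2 h4 (by linarith) (by linarith)
      nlinarith
    · rw [sub_zero, sub_self, abs_zero]; linarith

/-- The proportion of neighbours in community `b` for a vertex of community `a`. -/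
def blockShare {K : ℕ} (θ ρ : ℝ) (a b : Fin K) : ℝ := blockProb θ ρ a b / (K * ρ + (θ - ρ))

theorem blockShare_nonneg (hρ : 0 < ρ) (hρθ : ρ < θ) (a b : Fin K) : 0 ≤ blockShare θ ρ a b := by
  have h : 0 < θ - ρ := sub_pos.2 hρθ
  apply div_nonneg _ (by positivity)
  unfold blockProb
  split_ifs <;> linarith

theorem sum_blockShare (hρ : 0 < ρ) (hρθ : ρ < θ) (a : Fin K) : ∑ b, blockShare θ ρ a b = 1 := by
  have h : 0 < θ - ρ := sub_pos.2 hρθ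
  simp only [blockShare, ← Finset.sum_div, sum_blockProb]
  exact div_self (by positivity)

theorem blockShare_le_one (hρ : 0 < ρ) (hρθ : ρ < θ) (a b : Fin K) : blockShare θ ρ a b ≤ 1 := by
  rw [← sum_blockShare hρ hρθ a]
  exact Finset.single_le_sum (fun c _ => blockShare_nonneg hρ hρθ a c) (Finset.mem_univ b)

/-- The overlap of the neighbourhood profiles of the communities `a` and `b`. -/
def blockOverlap {K : ℕ} (θ ρ : ℝ) (a b : Fin K) : ℝ :=
  ∑ c, blockShare θ ρ a c * blockShare θ ρ b c

theorem blockOverlap_eq (a b : Fin K) : blockOverlap θ ρ a b =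
    (K * ρ ^ 2 + 2 * ρ * (θ - ρ) + (θ - ρ) ^ 2 * (if a = b then 1 else 0)) /
      (K * ρ + (θ - ρ)) ^ 2 := by
  simp only [blockOverlap, blockShare, div_mul_div_comm, ← Finset.sum_div, sum_blockProb_mul]
  rw [← sq]

theorem blockOverlap_nonneg (hρ : 0 < ρ) (hρθ : ρ < θ) (a b : Fin K) :
    0 ≤ blockOverlap θ ρ a b :=
  Finset.sum_nonneg fun c _ =>
    mul_nonneg (blockShare_nonneg hρ hρθ a c) (blockShare_nonneg hρ hρθ b c)

theorem blockOverlap_le_one (hρ : 0 < ρ) (hρθ : ρ < θ) (a b : Fin K) :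
    blockOverlap θ ρ a b ≤ 1 := by
  rw [← sum_blockShare hρ hρθ a]
  exact Finset.sum_le_sum fun c _ =>
    mul_le_of_le_one_right (blockShare_nonneg hρ hρθ a c) (blockShare_le_one hρ hρθ b c)

/-- The comparison is with the actual size `|C_i|` rather than its mean, because `N_ij` is built
from actual sizes. The fluctuation of the size then enters the error. -/
theorem communityCount_close {n : ℕ} {η : ℝ} (hρ : 0 < ρ) (hρθ : ρ < θ)
    {Y : Matrix (Vertex K n) (Vertex K n) ℝ} (hY : IsAdj Y)
    (hcnt : ∀ (i : Vertex K n) (a : Fin K), |∑ m, Y i (a, m) - n * blockProb θ ρ i.1 a| ≤ η)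
    (i : Vertex K n) (c : Fin K) :
    |∑ m, Y i (c, m) - localSize Y i * blockShare θ ρ i.1 c| ≤ (K + 1) * η := by
  have hr : 0 < K * ρ + (θ - ρ) := by
    have h : 0 < θ - ρ := sub_pos.2 hρθ
    positivity
  have h1 := hcnt i c
  have h4 : n * blockProb θ ρ i.1 c = n * (K * ρ + (θ - ρ)) * blockShare θ ρ i.1 c := by
    unfold blockShare
    field_simp
  have h2 : ∑ m, Y i (c, m) - localSize Y i * blockShare θ ρ i.1 c =
      (∑ m, Y i (c, m) - n * (K * ρ + (θ - ρ)) * blockShare θ ρ i.1 c) -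
        (localSize Y i - n * (K * ρ + (θ - ρ))) * blockShare θ ρ i.1 c := by ring
  rw [h2, ← h4]
  refine (abs_sub _ _).trans ?_
  rw [abs_mul (localSize Y i - _), abs_of_nonneg (blockShare_nonneg hρ hρθ i.1 c)]
  have h0 : 0 ≤ η := (abs_nonneg _).trans h1
  have h3 := mul_le_mul (localSize_close hY hcnt i) (blockShare_le_one hρ hρθ i.1 c)
    (blockShare_nonneg hρ hρθ i.1 c) (by positivity)
  linarith

theorem commonCount_close {n : ℕ} {η : ℝ} (hρ : 0 < ρ) (hρθ : ρ < θ)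
    {Y : Matrix (Vertex K n) (Vertex K n) ℝ} (hY : IsAdj Y)
    (hcnt : ∀ (i : Vertex K n) (a : Fin K), |∑ m, Y i (a, m) - n * blockProb θ ρ i.1 a| ≤ η)
    (i j : Vertex K n) :
    |∑ c, (∑ m, Y i (c, m)) * (∑ m, Y j (c, m)) -
      localSize Y i * localSize Y j * blockOverlap θ ρ i.1 j.1| ≤
      (K + 1) * η * (localSize Y j + localSize Y i) := by
  have h1 : ∑ c, (∑ m, Y i (c, m)) * (∑ m, Y j (c, m)) -
      localSize Y i * localSize Y j * blockOverlap θ ρ i.1 j.1 =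
      ∑ c, ((∑ m, Y i (c, m) - localSize Y i * blockShare θ ρ i.1 c) * (∑ m, Y j (c, m)) +
        localSize Y i * blockShare θ ρ i.1 c *
          (∑ m, Y j (c, m) - localSize Y j * blockShare θ ρ j.1 c)) := by
    rw [blockOverlap, Finset.mul_sum, ← Finset.sum_sub_distrib]
    exact Finset.sum_congr rfl fun c _ => by ring
  rw [h1]
  refine (Finset.abs_sum_le_sum_abs _ _).trans ?_
  calc _ ≤ ∑ c, ((K + 1) * η * (∑ m, Y j (c, m)) +
        localSize Y i * blockShare θ ρ i.1 c * ((K + 1) * η)) := by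
        apply Finset.sum_le_sum
        intro c _
        have hsum : 0 ≤ ∑ m, Y j (c, m) := Finset.sum_nonneg fun m _ => hY.nonneg _ _
        have hdp : 0 ≤ localSize Y i * blockShare θ ρ i.1 c :=
          mul_nonneg (hY.localSize_nonneg i) (blockShare_nonneg hρ hρθ _ _)
        refine (abs_add_le _ _).trans (add_le_add ?_ ?_)
        · rw [abs_mul, abs_of_nonneg hsum]
          exact mul_le_mul_of_nonneg_right (communityCount_close hρ hρθ hY hcnt i c) hsum
        · rw [abs_mul, abs_of_nonneg hdp]
          exact mul_le_mul_of_nonneg_left (communityCount_close hρ hρθ hY hcnt j c) hdp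
    _ = _ := by
        rw [Finset.sum_add_distrib, ← Finset.mul_sum, ← Finset.sum_mul, ← Finset.mul_sum,
          sum_blockShare hρ hρθ, ← hY.localSize_eq_sum_sum]
        ring

theorem IsAdj.sum_mul_blockProb {n : ℕ} {Y : Matrix (Vertex K n) (Vertex K n) ℝ} (hY : IsAdj Y)
    (i j : Vertex K n) :
    ∑ x : Vertex K n × Vertex K n, Y i x.1 * Y j x.2 * blockProb θ ρ x.1.1 x.2.1 =
      ρ * (localSize Y i * localSize Y j) +
        (θ - ρ) * ∑ c, (∑ m, Y i (c, m)) * (∑ m, Y j (c, m)) := by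
  have h1 : ∀ x : Vertex K n × Vertex K n, Y i x.1 * Y j x.2 * blockProb θ ρ x.1.1 x.2.1 =
      ρ * (Y i x.1 * Y j x.2) + (θ - ρ) * (if x.1.1 = x.2.1 then Y i x.1 * Y j x.2 else 0) := by
    intro x
    rw [blockProb_eq]
    split_ifs <;> ring
  simp only [h1, Finset.sum_add_distrib, ← Finset.mul_sum]
  rw [sum_mul_row, ← hY.localSize_eq, ← hY.localSize_eq]
  congr 2
  simp only [Fintype.sum_prod_type]
  apply Finset.sum_congr rfl
  intro a _
  rw [Finset.sum_mul_sum]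
  apply Finset.sum_congr rfl
  intro m _
  rw [Finset.sum_eq_single a]
  · simp
  · intro b _ hba
    simp [Ne.symm hba]
  · simp

/-- The error budget of `pairMean_close`, in units of `D² u`: bias `4`, edge noise `12`, degenerate
pairs `6`, community counts `k`, and `2` for `N_ij` against `|C_i| |C_j|`. -/
theorem abs_sub_mul_le_of_close {θ ρ g R dd N D u k S X P M : ℝ} (hD : 0 < D) (hu : 0 < u)
    (hg0 : 0 ≤ g) (hgθ : g ≤ θ) (ht0 : 0 ≤ ρ + g * R) (ht1 : ρ + g * R ≤ θ)
    (hθ : θ ≤ D * u) (hN : |dd - N| ≤ 2 * D) (hS : |S - X| ≤ 4 * (D ^ 2 * u))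
    (hX : |X - P| ≤ 12 * (D ^ 2 * u)) (hP : |P - (ρ * dd + g * M)| ≤ 6 * (D ^ 2 * u))
    (hM : θ * |M - dd * R| ≤ k * (D ^ 2 * u)) :
    |S - (ρ + g * R) * N| ≤ (k + 24) * (D ^ 2 * u) := by
  have t3 : |g * (M - dd * R)| ≤ k * (D ^ 2 * u) := by
    rw [abs_mul, abs_of_nonneg hg0]
    exact (mul_le_mul_of_nonneg_right hgθ (abs_nonneg _)).trans hM
  have t4 : |(ρ + g * R) * (dd - N)| ≤ 2 * (D ^ 2 * u) := by
    rw [abs_mul, abs_of_nonneg ht0]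
    calc _ ≤ (D * u) * (2 * D) := mul_le_mul (ht1.trans hθ) hN (abs_nonneg _) (by positivity)
      _ = _ := by ring
  have e : S - (ρ + g * R) * N = (S - X) + (X - P) + (P - (ρ * dd + g * M)) + g * (M - dd * R)
      + (ρ + g * R) * (dd - N) := by ring
  rw [e]
  generalize g * (M - dd * R) = z₁ at *
  generalize (ρ + g * R) * (dd - N) = z₂ at *
  have a1 := abs_le.1 hP
  have a2 := abs_le.1 hX
  have a3 := abs_le.1 hS
  have a4 := abs_le.1 t3
  have a5 := abs_le.1 t4
  rw [abs_le]
  constructor <;> linarith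

/-- The estimates `S_ij / N_ij` concentrate around two values, depending on whether `i` and `j`
lie in the same community. -/
theorem pairMean_close {n : ℕ} {u b : ℝ} (hρ : 0 < ρ) (hρθ : ρ < θ)
    {Y S : Matrix (Vertex K n) (Vertex K n) ℝ} (hY : IsAdj Y)
    (hθ1 : θ ≤ 1) (hnu : 1 ≤ n * u) (hLu : 20 * K * u ≤ θ) (hb : b ≤ n * θ * u)
    {D : ℝ} (hD : D = n * (K * ρ + (θ - ρ)))
    (hcnt : ∀ (i : Vertex K n) (a : Fin K),
      |∑ m, Y i (a, m) - n * blockProb θ ρ i.1 a| ≤ 10 * (n * u))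
    (hnoise : ∀ i j : Vertex K n, localSize Y i ≤ 2 * D → localSize Y j ≤ 2 * D →
      |∑ x : Vertex K n × Vertex K n,
        spread Y i j x * (Y x.1 x.2 - blockProb θ ρ x.1.1 x.2.1)| ≤ 12 * (D ^ 2 * u))
    (hS : ∀ i j, |S i j - debiasedEdgeCount Y Y i j| ≤ b * (localSize Y i + localSize Y j))
    (i j : Vertex K n) :
    D ^ 2 / 8 ≤ pairCount Y i j ∧ pairCount Y i j ≤ 4 * D ^ 2 ∧
    |pairMean S (pairCount Y) i j - (ρ + (θ - ρ) * blockOverlap θ ρ i.1 j.1)| ≤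
      512 * (K + 1) * u := by
  have hK : (1 : ℝ) ≤ K := by
    have : 0 < K := i.1.pos
    exact_mod_cast this
  have hθ0 : 0 < θ := hρ.trans hρθ
  have hg0 : 0 < θ - ρ := sub_pos.2 hρθ
  have hn : (0 : ℝ) ≤ n := Nat.cast_nonneg n
  have hu : 0 < u := by
    by_contra h
    nlinarith
  have hnθ : (n : ℝ) * θ ≤ D := by
    rw [hD]
    have : ρ ≤ K * ρ := le_mul_of_one_le_left hρ.le hK
    gcongr
    linarith
  have hKnu : 20 * (K * (n * u)) ≤ D := by
    have : (n : ℝ) * (20 * K * u) ≤ n * θ := by gcongr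
    linarith
  have hD20 : 20 ≤ D := by nlinarith
  have hD0 : 0 < D := by linarith
  have hd : ∀ i, |localSize Y i - D| ≤ K * (10 * (n * u)) := fun i => by
    rw [hD]; exact localSize_close hY hcnt i
  have hd1 : ∀ i, D / 2 ≤ localSize Y i := fun i => by
    have := (abs_le.1 (hd i)).1
    linarith
  have hd2 : ∀ i, localSize Y i ≤ 2 * D := fun i => by
    have := (abs_le.1 (hd i)).2
    linarith
  have hd0 : ∀ i, 0 ≤ localSize Y i := hY.localSize_nonneg
  obtain ⟨hN0, hN1, hN2⟩ := pairCount_bounds (by linarith) hd1 hd2 i j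
  refine ⟨hN0, hN1, ?_⟩
  have hNpos : 0 < pairCount Y i j := lt_of_lt_of_le (by positivity) hN0
  have hR0 := blockOverlap_nonneg hρ hρθ i.1 j.1
  have hR1 := blockOverlap_le_one hρ hρθ i.1 j.1
  have hDu : n * θ * u ≤ D * u := by gcongr
  have hθDu : θ ≤ D * u := by nlinarith
  have hspread := hY.sum_spread_close i j (fun k l => blockProb θ ρ k.1 l.1) (θ := θ)
    (fun k l => by unfold blockProb; split_ifs <;> linarith)
    (fun k l => by unfold blockProb; split_ifs <;> linarith)
  rw [hY.sum_mul_blockProb] at hspread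
  have hX := hnoise i j (hd2 i) (hd2 j)
  have hSij := hS i j
  rw [hY.debiasedEdgeCount_eq] at hSij
  simp only [mul_sub, Finset.sum_sub_distrib] at hX
  have t1 : θ * (2 * localSize Y i + localSize Y j) ≤ 6 * (D ^ 2 * u) := by
    have hi := hd2 i
    have hj := hd2 j
    calc _ ≤ (D * u) * (6 * D) := mul_le_mul hθDu (by linarith)
          (by linarith [hd0 i, hd0 j]) (by positivity)
      _ = _ := by ring
  have t2 : b * (localSize Y i + localSize Y j) ≤ 4 * (D ^ 2 * u) := by
    have hi := hd2 i
    have hj := hd2 j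
    calc _ ≤ (D * u) * (4 * D) := mul_le_mul (hb.trans hDu) (by linarith)
          (by linarith [hd0 i, hd0 j]) (by positivity)
      _ = _ := by ring
  have t3 := commonCount_close hρ hρθ hY hcnt i j
  have t4 : θ * ((K + 1) * (10 * (n * u)) * (localSize Y j + localSize Y i)) ≤
      40 * (K + 1) * (D ^ 2 * u) := by
    have hi := hd2 i
    have hj := hd2 j
    calc _ = 10 * (K + 1) * u * ((n * θ) * (localSize Y j + localSize Y i)) := by ring
      _ ≤ 10 * (K + 1) * u * (D * (4 * D)) := by
          apply mul_le_mul_of_nonneg_left _ (by positivity)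
          exact mul_le_mul hnθ (by linarith) (by linarith [hd0 i, hd0 j]) hD0.le
      _ = _ := by ring
  have total := abs_sub_mul_le_of_close hD0 hu
    hg0.le (by linarith) (by positivity) (by nlinarith) hθDu hN2 (hSij.trans t2) hX
    (hspread.trans t1) ((mul_le_mul_of_nonneg_left t3 hθ0.le).trans t4)
  unfold pairMean
  rw [div_sub' hNpos.ne', abs_div, abs_of_pos hNpos, div_le_iff₀ hNpos, mul_comm (pairCount _ _ _)]
  refine total.trans ?_
  -- Here `k = 40 (K + 1)`, so `k + 24 ≤ 64 (K + 1) = 512 (K + 1) / 8`, the `8` coming from `N ≥ D²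
  -- / 8`.
  calc _ ≤ 512 * (K + 1) * u * (D ^ 2 / 8) := by
        have : 0 ≤ D ^ 2 * u := by positivity
        nlinarith
    _ ≤ _ := by gcongr

end Block

end

noncomputable section

/-! Concentration for the stochastic block model. -/

section Concentration

variable {K n : ℕ}

theorem isAdj_adjacency (ω : Sym2 (Vertex K n) → Bool) : IsAdj (adjacency ω) where
  zero_or_one i j := by unfold adjacency; split_ifs <;> simp
  symm i j := by unfold adjacency; simp only [ne_comm, Sym2.eq_swap]
  diag i := by simp [adjacency]

theorem adjacency_eq_bit (ω : Sym2 (Vertex K n) → Bool) {i j : Vertex K n} (h : i ≠ j) :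
    adjacency ω i j = bit (ω s(i, j)) := by
  simp [adjacency, bit, h]

theorem edgeProb_eq (θ ρ : I) (i j : Vertex K n) :
    (edgeProb θ ρ s(i, j) : ℝ) = blockProb θ ρ i.1 j.1 := by
  unfold edgeProb blockProb
  simp only [Sym2.lift_mk]
  split_ifs <;> rfl

variable {θ ρ : I} {u : ℝ}

theorem blockProb_nonneg (a b : Fin K) : 0 ≤ blockProb (θ : ℝ) ρ a b := by
  unfold blockProb
  split_ifs
  exacts [θ.2.1, ρ.2.1]

theorem blockProb_le (hρθ : (ρ : ℝ) ≤ θ) (a b : Fin K) : blockProb (θ : ℝ) ρ a b ≤ θ := by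
  unfold blockProb
  split_ifs
  exacts [le_rfl, hρθ]

/-- Chernoff with deterministic weights and `s = u / (2θ)`: deviation `9nu` and variance `nθ` give
the exponent `(-9/2 + 1/2) n u² / θ`. The tenth `nu` absorbs the missing loop at `i`, whose mean is
at most `1 ≤ nu`. -/
theorem measure_communityCount_far_le (hρθ : (ρ : ℝ) ≤ θ) (hθ : 0 < (θ : ℝ)) (hu0 : 0 ≤ u)
    (huθ : u ≤ θ) (hnu : 1 ≤ n * u) (hu : Real.log n * θ ≤ n * u ^ 2) (i : Vertex K n)
    (a : Fin K) :
    (sbmMeasure K n θ ρ).real {ω | ¬ |∑ m, adjacency ω i (a, m) - n * blockProb θ ρ i.1 a| ≤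
      10 * (n * u)} ≤ 2 * Real.exp (-(4 * Real.log n)) := by
  have hch := predictable_chernoff (X := Vertex K n) (edgeProb θ ρ) ∅ (fun k => s(i, k))
    (fun e => by
      refine le_trans (Finset.card_le_one.2 ?_) one_le_two
      intro x hx y hy
      have := (Finset.mem_filter.1 hx).2.trans (Finset.mem_filter.1 hy).2.symm
      simp only [Sym2.eq_iff, true_and] at this
      rcases this with h | ⟨h1, h2⟩
      exacts [h, h2.trans h1])
    (fun _ k => if k ≠ i ∧ k.1 = a then 1 else 0)
    (fun _ k => by split_ifs <;> norm_num) (fun _ k => by split_ifs <;> norm_num)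
    (fun _ _ _ => rfl) (fun _ _ h => absurd h (Finset.notMem_empty _))
    (s := u / (2 * θ)) (by positivity)
    (by rw [div_le_iff₀ (by positivity)]; linarith) (n * θ) (9 * (n * u))
  refine (measureReal_mono ?_).trans (hch.trans ?_)
  · intro ω hω
    rw [Set.mem_ofPred_eq, not_le] at hω
    constructor
    · calc _ ≤ ∑ k : Vertex K n, (if k.1 = a then (θ : ℝ) else 0) := by
            apply Finset.sum_le_sum
            intro k _
            rw [edgeProb_eq]
            have h1 := blockProb_le hρθ i.1 k.1
            have h0 : (0 : ℝ) ≤ θ := hθ.le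
            split_ifs with h2 h3 <;> simp_all
        _ = _ := by
            rw [Fintype.sum_prod_type, Finset.sum_comm]
            simp
    · have hid : ∑ k : Vertex K n, (if k ≠ i ∧ k.1 = a then (1 : ℝ) else 0) *
          (bit (ω s(i, k)) - edgeProb θ ρ s(i, k)) =
          (∑ m, adjacency ω i (a, m) - n * blockProb θ ρ i.1 a) +
            (if i.1 = a then blockProb (θ : ℝ) ρ i.1 a else 0) := by
        have hpt : ∀ k : Vertex K n, (if k ≠ i ∧ k.1 = a then (1 : ℝ) else 0) *
            (bit (ω s(i, k)) - edgeProb θ ρ s(i, k)) =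
            (if k.1 = a then adjacency ω i k - blockProb (θ : ℝ) ρ i.1 a else 0) +
            (if k = i then (if i.1 = a then blockProb (θ : ℝ) ρ i.1 a else 0) else 0) := by
          intro k
          rw [edgeProb_eq]
          by_cases hki : k = i
          · subst hki
            by_cases hka : k.1 = a
            · simp [hka, (isAdj_adjacency ω).diag]
            · simp [hka]
          · rw [adjacency_eq_bit ω (Ne.symm hki)]
            by_cases hka : k.1 = a
            · simp [hki, hka]
            · simp [hki, hka]
        simp only [hpt, Finset.sum_add_distrib, Finset.sum_ite_eq', Finset.mem_univ, if_true]
        congr 1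
        rw [Fintype.sum_prod_type, Finset.sum_eq_single a]
        · simp [Finset.sum_sub_distrib]
        · intro b _ hb
          simp [hb]
        · simp
      rw [hid]
      have hc : |(if i.1 = a then blockProb (θ : ℝ) ρ i.1 a else 0)| ≤ 1 := by
        have h1 := blockProb_le hρθ i.1 a
        have h2 := blockProb_nonneg (θ := θ) (ρ := ρ) i.1 a
        have h3 : (θ : ℝ) ≤ 1 := θ.2.2
        split_ifs
        · rw [abs_of_nonneg h2]; linarith
        · simp
      have := abs_sub_abs_le_abs_sub (∑ m, adjacency ω i (a, m) - n * blockProb (θ : ℝ) ρ i.1 a)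
        (-(if i.1 = a then blockProb (θ : ℝ) ρ i.1 a else 0))
      rw [abs_neg, sub_neg_eq_add] at this
      linarith
  · have h4 : Real.log n ≤ n * u ^ 2 / θ := by rwa [le_div_iff₀ hθ]
    have h5 : -(u / (2 * (θ : ℝ)) * (9 * (n * u))) + 2 * (u / (2 * (θ : ℝ))) ^ 2 * (n * θ) =
        -(4 * (n * u ^ 2 / θ)) := by
      field_simp
      ring
    rw [h5]
    gcongr

theorem card_filter_mk_eq_le_two {V : Type*} [Fintype V] [DecidableEq V] (e : Sym2 V) :
    (Finset.univ.filter fun x : V × V => s(x.1, x.2) = e).card ≤ 2 := by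
  induction e using Sym2.ind with
  | _ a b =>
    refine le_trans (Finset.card_le_card (t := {(a, b), (b, a)}) ?_) Finset.card_le_two
    intro x hx
    have := (Finset.mem_filter.1 hx).2
    rw [Sym2.eq_iff] at this
    simp only [Finset.mem_insert, Finset.mem_singleton, Prod.ext_iff]
    tauto

/-- Here `F` consists of the pairs meeting `i` or `j`; they determine the weights `spread`, which
vanish on them. The size bounds keep the variance below `4θD²`, and `s = u / (2θ)` gives the
exponent `(-6 + 2) D² u² / θ`. -/
theorem measure_noise_far_le {D : ℝ} (hρθ : (ρ : ℝ) ≤ θ) (hθ : 0 < (θ : ℝ)) (hu0 : 0 ≤ u)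
    (huθ : u ≤ θ) (hD : 0 ≤ D) (hu : Real.log n * θ ≤ D ^ 2 * u ^ 2) (i j : Vertex K n) :
    (sbmMeasure K n θ ρ).real {ω | ¬ (localSize (adjacency ω) i ≤ 2 * D →
      localSize (adjacency ω) j ≤ 2 * D →
      |∑ x : Vertex K n × Vertex K n, spread (adjacency ω) i j x *
        (adjacency ω x.1 x.2 - blockProb θ ρ x.1.1 x.2.1)| ≤ 12 * (D ^ 2 * u))} ≤
      2 * Real.exp (-(4 * Real.log n)) := by
  have hch := predictable_chernoff (X := Vertex K n × Vertex K n) (edgeProb θ ρ)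
    (Finset.univ.filter fun e => i ∈ e ∨ j ∈ e) (fun x => s(x.1, x.2)) card_filter_mk_eq_le_two
    (fun ω x => spread (adjacency ω) i j x)
    (fun ω x => (isAdj_adjacency ω).spread_nonneg i j x)
    (fun ω x => ((isAdj_adjacency ω).spread_le i j x).trans
      (mul_le_one₀ ((isAdj_adjacency ω).le_one _ _) ((isAdj_adjacency ω).nonneg _ _)
        ((isAdj_adjacency ω).le_one _ _)))
    (fun ω ω' h => by
      funext x
      have h1 : ω s(i, x.1) = ω' s(i, x.1) := h _ (by simp)
      have h2 : ω s(j, x.2) = ω' s(j, x.2) := h _ (by simp)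
      simp only [spread, adjacency, h1, h2])
    (fun ω x hx => by
      simp only [Finset.mem_filter, Finset.mem_univ, true_and, Sym2.mem_iff] at hx
      unfold spread
      rw [if_neg]
      rintro ⟨⟨h1, h2⟩, ⟨h3, h4⟩, -⟩
      rcases hx with (h | h) | (h | h)
      exacts [h1 h.symm, h3 h.symm, h2 h.symm, h4 h.symm])
    (s := u / (2 * θ)) (by positivity)
    (by rw [div_le_iff₀ (by positivity)]; linarith) (4 * (θ * D ^ 2)) (12 * (D ^ 2 * u))
  refine (measureReal_mono ?_).trans (hch.trans ?_)
  · intro ω hω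
    rw [Set.mem_ofPred_eq] at hω
    push Not at hω
    obtain ⟨h1, h2, h3⟩ := hω
    have hY := isAdj_adjacency ω
    constructor
    · calc _ ≤ ∑ x : Vertex K n × Vertex K n,
            (adjacency ω i x.1 * adjacency ω j x.2) * (θ : ℝ) := by
            apply Finset.sum_le_sum
            intro x _
            rw [edgeProb_eq]
            exact mul_le_mul (hY.spread_le i j x) (blockProb_le hρθ _ _) (blockProb_nonneg _ _)
              (mul_nonneg (hY.nonneg _ _) (hY.nonneg _ _))
        _ = localSize (adjacency ω) i * localSize (adjacency ω) j * θ := by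
            rw [← Finset.sum_mul, sum_mul_row, hY.localSize_eq, hY.localSize_eq]
        _ ≤ (2 * D) * (2 * D) * θ := by
            gcongr
            exact hY.localSize_nonneg j
        _ = _ := by ring
    · refine h3.le.trans (le_of_eq ?_)
      congr 1
      apply Finset.sum_congr rfl
      intro x _
      rw [edgeProb_eq]
      by_cases hx : x.1 = x.2
      · simp [spread, hx]
      · rw [adjacency_eq_bit ω hx]
  · have h4 : Real.log n ≤ D ^ 2 * u ^ 2 / θ := by rwa [le_div_iff₀ hθ]
    have h5 : -(u / (2 * (θ : ℝ)) * (12 * (D ^ 2 * u))) +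
        2 * (u / (2 * (θ : ℝ))) ^ 2 * (4 * (θ * D ^ 2)) = -(4 * (D ^ 2 * u ^ 2 / θ)) := by
      field_simp
      ring
    rw [h5]
    gcongr

end Concentration

end

/-! ### Exact recovery for a fixed number of vertices. -/

noncomputable section

/-- The ratio required between the signal `(θ - ρ)³ / θ²` and the noise level. -/
def signalConst (K : ℕ) (C : ℝ) : ℝ := 614400 * (K + 1) * K ^ 2 * C

theorem le_signalConst {K : ℕ} {C : ℝ} (hK : 1 ≤ K) (hC : 1 ≤ C) : 614400 * K ≤ signalConst K C := by
  unfold signalConst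
  have hK' : (1 : ℝ) ≤ K := by exact_mod_cast hK
  calc 614400 * (K : ℝ) = 614400 * K * 1 * 1 := by ring
    _ ≤ 614400 * (K + 1) * K ^ 2 * C := by
      gcongr
      · linarith
      · nlinarith

/-- One step of the algorithm with an edge count close to the debiased one recovers the
communities with high probability, if the signal dominates the noise level `u`. -/
theorem exists_threshold {K n : ℕ} {C u b : ℝ} {θ ρ : I} (hK : 1 ≤ K) (hC : 1 ≤ C)
    (hρ : 0 < (ρ : ℝ)) (hρθ : (ρ : ℝ) < θ) (hθ : (θ : ℝ) ≤ 1 / 2) (hCρ : (θ : ℝ) ≤ C * ρ)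
    (hnu : 1 ≤ n * u) (hsig : signalConst K C * u * θ ^ 2 ≤ (θ - ρ : ℝ) ^ 3)
    (h1 : Real.log n * θ ≤ n * u ^ 2) (h2 : Real.log n ≤ θ * n ^ 2 * u ^ 2)
    (hb : b ≤ n * θ * u)
    (S : Matrix (Vertex K n) (Vertex K n) ℝ → Matrix (Vertex K n) (Vertex K n) ℝ)
    (hS : ∀ Y, IsAdj Y → ∀ i j,
      |S Y i j - debiasedEdgeCount Y Y i j| ≤ b * (localSize Y i + localSize Y j)) :
    ∃ lam : ℝ, 1 - 4 * (n * K) ^ 2 * Real.exp (-(4 * Real.log n)) ≤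
      (sbmMeasure K n θ ρ).real {ω | ∀ i j, updatedWeights (S (adjacency ω))
        (pairCount (adjacency ω)) lam i j = trueWeights K n i j} := by
  have hθ0 : 0 < (θ : ℝ) := hρ.trans hρθ
  have hg0 : 0 < (θ - ρ : ℝ) := sub_pos.2 hρθ
  have hKR : (1 : ℝ) ≤ K := by exact_mod_cast hK
  have hn : (0 : ℝ) ≤ n := Nat.cast_nonneg n
  have hu0 : 0 < u := by
    by_contra h
    nlinarith
  have hLK := le_signalConst hK hC
  have hLu : signalConst K C * u ≤ θ := by
    have : (θ - ρ : ℝ) ^ 3 ≤ θ ^ 3 := by gcongr; linarith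
    have h3 : signalConst K C * u * θ ^ 2 ≤ θ * θ ^ 2 := by linarith
    exact le_of_mul_le_mul_right h3 (by positivity)
  have hKu : 614400 * (K * u) ≤ θ := by
    have := mul_le_mul_of_nonneg_right hLK hu0.le
    linarith
  have hKu' : u ≤ K * u := le_mul_of_one_le_left hu0.le hKR
  have hKu0 : 0 < K * u := by positivity
  set D : ℝ := n * (K * ρ + (θ - ρ)) with hD
  set r : ℝ := K * ρ + (θ - ρ) with hr
  have hr0 : 0 < r := by positivity
  have hrθ : (θ : ℝ) ≤ r := by
    have := le_mul_of_one_le_left hρ.le hKR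
    linarith
  have hrK : r ≤ K * θ := by
    have := le_mul_of_one_le_left hg0.le hKR
    linarith
  have hn0 : (0 : ℝ) < n := by
    rcases hn.eq_or_lt with h | h
    · rw [← h] at hnu; linarith
    · exact h
  have hD0 : 0 < D := by positivity
  have hDθ : n * (θ : ℝ) ≤ D := by rw [hD]; gcongr
  set ε : ℝ := 512 * (K + 1) * u with hε
  set Δ : ℝ := (θ - ρ) ^ 3 / r ^ 2 with hΔ
  have hεΔ : 600 * C * ε < Δ := by
    have e1 : signalConst K C * u * θ ^ 2 / (K * θ) ^ 2 ≤ Δ := by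
      rw [hΔ]
      gcongr
    -- This identity fixes `signalConst`: `614400 = 2 * 600 * 512`, the factor `K²` pays for `r ≤
    -- Kθ`, and the `2` leaves room for strictness.
    have e2 : signalConst K C * u * θ ^ 2 / (K * θ) ^ 2 = 2 * (600 * C * ε) := by
      rw [hε, signalConst]
      field_simp
      ring
    have : 0 < 600 * C * ε := by positivity
    linarith
  refine ⟨384 * C * D ^ 2 * ε ^ 2 / θ, ?_⟩
  set μ := sbmMeasure K n θ ρ with hμ
  set A : Vertex K n × Fin K → Set (Sym2 (Vertex K n) → Bool) := fun x =>
    {ω | ¬ |∑ m, adjacency ω x.1 (x.2, m) - n * blockProb θ ρ x.1.1 x.2| ≤ 10 * (n * u)} with hA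
  set B : Vertex K n × Vertex K n → Set (Sym2 (Vertex K n) → Bool) := fun y =>
    {ω | ¬ (localSize (adjacency ω) y.1 ≤ 2 * D → localSize (adjacency ω) y.2 ≤ 2 * D →
      |∑ x : Vertex K n × Vertex K n, spread (adjacency ω) y.1 y.2 x *
        (adjacency ω x.1 x.2 - blockProb θ ρ x.1.1 x.2.1)| ≤ 12 * (D ^ 2 * u))} with hB
  have hAle : ∀ x, μ.real (A x) ≤ 2 * Real.exp (-(4 * Real.log n)) := fun x =>
    measure_communityCount_far_le hρθ.le hθ0 hu0.le (by linarith) hnu h1 x.1 x.2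
  have hBle : ∀ y, μ.real (B y) ≤ 2 * Real.exp (-(4 * Real.log n)) := fun y =>
    measure_noise_far_le hρθ.le hθ0 hu0.le (by linarith) hD0.le (by
      calc _ ≤ (θ : ℝ) * n ^ 2 * u ^ 2 * θ := by gcongr
        _ = (n * (θ : ℝ)) ^ 2 * u ^ 2 := by ring
        _ ≤ D ^ 2 * u ^ 2 := by gcongr) y.1 y.2
  have hsub : ((⋃ x, A x) ∪ ⋃ y, B y)ᶜ ⊆ {ω | ∀ i j, updatedWeights (S (adjacency ω))
      (pairCount (adjacency ω)) (384 * C * D ^ 2 * ε ^ 2 / θ) i j = trueWeights K n i j} := by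
    intro ω hω
    have hω' : (∀ x, ω ∉ A x) ∧ ∀ y, ω ∉ B y := by
      simpa only [Set.compl_union, Set.mem_inter_iff, Set.mem_compl_iff, Set.mem_iUnion,
        not_exists] using hω
    have hc := pairMean_close (S := S (adjacency ω)) hρ hρθ (isAdj_adjacency ω)
      (by linarith) hnu (by linarith) hb hD
      (fun i a => by have := hω'.1 (i, a); simpa only [hA, Set.mem_ofPred_eq, not_not] using this)
      (fun i j => by have := hω'.2 (i, j); simpa only [hB, Set.mem_ofPred_eq, not_not] using this)
      (hS _ (isAdj_adjacency ω))
    rw [Set.mem_ofPred_eq]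
    intro i j
    set q : ℝ := ρ + (θ - ρ) * ((K * ρ ^ 2 + 2 * ρ * (θ - ρ)) / r ^ 2) with hq
    -- The overlap takes two values, and their difference multiplied by `θ - ρ` is the signal `Δ`.
    have hcase : ∀ a b : Fin K, ρ + (θ - ρ : ℝ) * blockOverlap θ ρ a b =
        if a = b then q + Δ else q := by
      intro a b
      rw [blockOverlap_eq, hq, hΔ]
      split_ifs <;> ring
    have hqρ : (ρ : ℝ) ≤ q := by
      have : 0 ≤ (θ - ρ : ℝ) * ((K * ρ ^ 2 + 2 * ρ * (θ - ρ)) / r ^ 2) := by positivity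
      linarith
    have hqθ : q + Δ ≤ θ := by
      have e := hcase i.1 i.1
      rw [if_pos rfl] at e
      rw [← e]
      have := mul_le_mul_of_nonneg_left (blockOverlap_le_one hρ hρθ i.1 i.1) hg0.le
      linarith
    have := updatedWeights_eq_of_close (fun i : Vertex K n => i.1) (S (adjacency ω))
      (pairCount (adjacency ω)) (t := q + Δ) hC hD0 hθ0 hθ hqθ
      (by
        rw [add_sub_cancel_right]
        exact hCρ.trans (mul_le_mul_of_nonneg_left hqρ (by linarith)))
      (by positivity) hεΔ (fun i j => (hc i j).1) (fun i j => (hc i j).2.1)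
      (fun i j => by
        have h := (hc i j).2.2
        rw [hcase] at h
        rwa [add_sub_cancel_right]) i j
    rw [this, trueWeights]
  have hbad : μ.real ((⋃ x, A x) ∪ ⋃ y, B y) ≤
      4 * (n * K) ^ 2 * Real.exp (-(4 * Real.log n)) := by
    calc _ ≤ ∑ x, μ.real (A x) + ∑ y, μ.real (B y) :=
          (measureReal_union_le _ _).trans
            (add_le_add (measureReal_iUnion_fintype_le _) (measureReal_iUnion_fintype_le _))
      _ ≤ ∑ x : Vertex K n × Fin K, 2 * Real.exp (-(4 * Real.log n)) +
          ∑ y : Vertex K n × Vertex K n, 2 * Real.exp (-(4 * Real.log n)) := by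
          gcongr with x _ y _
          · exact hAle x
          · exact hBle y
      _ = (K * n * K + (n * K) ^ 2) * (2 * Real.exp (-(4 * Real.log n))) := by
          simp only [Finset.sum_const, Finset.card_univ, Fintype.card_prod, Fintype.card_fin,
            nsmul_eq_mul]
          push_cast
          ring
      _ ≤ ((n * K) ^ 2 + (n * K) ^ 2) * (2 * Real.exp (-(4 * Real.log n))) := by
          have h1n : (1 : ℝ) ≤ n := by
            have : 0 < n := by exact_mod_cast hn0
            exact_mod_cast this
          gcongr
          nlinarith [mul_nonneg hn (sub_nonneg.2 h1n), sq_nonneg (K : ℝ)]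
      _ = _ := by ring
  calc _ ≤ 1 - μ.real ((⋃ x, A x) ∪ ⋃ y, B y) := by linarith
    _ = μ.real ((⋃ x, A x) ∪ ⋃ y, B y)ᶜ := (probReal_compl_eq_one_sub .of_discrete).symm
    _ ≤ _ := measureReal_mono hsub

end

/-! Consistency along a sequence of models. -/

theorem tendsto_one_of_failure_le {K : ℕ} {x : ℕ → ℝ} (hx1 : ∀ n, x n ≤ 1)
    (hx : ∀ᶠ n : ℕ in atTop, 1 - 4 * (n * K) ^ 2 * Real.exp (-(4 * Real.log n)) ≤ x n) :
    Tendsto x atTop (𝓝 1) := by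
  have hlim : Tendsto (fun n : ℕ => 1 - 4 * (K : ℝ) ^ 2 * ((n : ℝ)⁻¹) ^ 2) atTop (𝓝 1) := by
    have := ((tendsto_inv_atTop_nhds_zero_nat (𝕜 := ℝ)).pow 2).const_mul (4 * (K : ℝ) ^ 2)
    simpa using this.const_sub 1
  refine tendsto_of_tendsto_of_tendsto_of_le_of_le' hlim tendsto_const_nhds ?_
    (Eventually.of_forall hx1)
  filter_upwards [hx, eventually_gt_atTop 0] with n hn hn0
  refine le_trans (le_of_eq ?_) hn
  have hn' : (0 : ℝ) < n := by exact_mod_cast hn0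
  have : Real.exp (4 * Real.log n) = (n : ℝ) ^ 4 := by
    rw [show (4 : ℝ) * Real.log n = ((4 : ℕ) : ℝ) * Real.log n by norm_num, Real.exp_nat_mul,
      Real.exp_log hn']
  rw [Real.exp_neg, this]
  field_simp

/-- Consistency of one step of the algorithm with an edge count that differs from the debiased one
by at most `b (|C_i| + |C_j|)`, if the signal dominates the noise levels. -/
theorem consistentExactRecovery_of_signal {K : ℕ} {C b : ℝ} (hK : 1 ≤ K) (hC : 1 ≤ C)
    {θ ρ : ℕ → I}
    (S : ∀ n, Matrix (Vertex K n) (Vertex K n) ℝ → Matrix (Vertex K n) (Vertex K n) ℝ)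
    (hS : ∀ n Y, IsAdj Y → ∀ i j,
      |S n Y i j - debiasedEdgeCount Y Y i j| ≤ b * (localSize Y i + localSize Y j))
    (hpar : ∀ᶠ n : ℕ in atTop, 0 < (ρ n : ℝ) ∧ (ρ n : ℝ) < θ n ∧ (θ n : ℝ) ≤ 1 / 2)
    (hCρ : ∀ᶠ n : ℕ in atTop, (θ n : ℝ) / ρ n ≤ C)
    (hA : ∀ᶠ n : ℕ in atTop, signalConst K C ^ 2 * Real.log n * (θ n : ℝ) ^ 3 ≤
      (θ n - ρ n : ℝ) ^ 6 * n ^ 2)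
    (hB : ∀ᶠ n : ℕ in atTop, signalConst K C ^ 2 * Real.log n * (θ n : ℝ) ^ 5 ≤
      (θ n - ρ n : ℝ) ^ 6 * n)
    (hb : ∀ᶠ n : ℕ in atTop, b * signalConst K C * θ n ≤ (θ n - ρ n : ℝ) ^ 3 * n) :
    ConsistentExactRecovery K θ ρ fun n Y lam => updatedWeights (S n Y) (pairCount Y) lam := by
  have hL : 0 < signalConst K C := by
    have : (1 : ℝ) ≤ K := by exact_mod_cast hK
    linarith [le_signalConst hK hC]
  have key : ∀ᶠ n : ℕ in atTop, ∃ lam : ℝ,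
      1 - 4 * (n * K) ^ 2 * Real.exp (-(4 * Real.log n)) ≤
      (sbmMeasure K n (θ n) (ρ n)).real {ω | ∀ i j, updatedWeights (S n (adjacency ω))
        (pairCount (adjacency ω)) lam i j = trueWeights K n i j} := by
    filter_upwards [hpar, hCρ, hA, hB, hb, eventually_ge_atTop 3] with n h1 h2 h3 h4 h5 hn
    obtain ⟨hρ, hρθ, hθ⟩ := h1
    have hθ0 : 0 < (θ n : ℝ) := hρ.trans hρθ
    have hg0 : 0 < (θ n - ρ n : ℝ) := sub_pos.2 hρθ
    have hn3 : (3 : ℝ) ≤ n := by exact_mod_cast hn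
    have hlog : 1 ≤ Real.log n := by
      rw [Real.le_log_iff_exp_le (by linarith)]
      linarith [Real.exp_one_lt_d9]
    -- The largest noise level that the signal tolerates. In terms of `u`, the hypotheses `hA`,
    -- `hB`, `hb` are the conditions on edge noise, community counts and bias.
    set u : ℝ := (θ n - ρ n) ^ 3 / (signalConst K C * θ n ^ 2) with hu
    have hu0 : 0 < u := by positivity
    have hus : signalConst K C * u * θ n ^ 2 = (θ n - ρ n : ℝ) ^ 3 := by
      rw [hu]; field_simp
    have hu6 : (θ n - ρ n : ℝ) ^ 6 = signalConst K C ^ 2 * u ^ 2 * θ n ^ 4 := by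
      rw [show (θ n - ρ n : ℝ) ^ 6 = ((θ n - ρ n : ℝ) ^ 3) ^ 2 by ring, ← hus]; ring
    rw [hu6] at h3 h4
    rw [← hus] at h5
    have e1 : Real.log n * θ n ≤ n * u ^ 2 := by
      have : (signalConst K C ^ 2 * (θ n : ℝ) ^ 4) * (Real.log n * θ n) ≤
          (signalConst K C ^ 2 * (θ n : ℝ) ^ 4) * (n * u ^ 2) := by linarith
      exact le_of_mul_le_mul_left this (by positivity)
    have e2 : Real.log n ≤ θ n * n ^ 2 * u ^ 2 := by
      have : (signalConst K C ^ 2 * (θ n : ℝ) ^ 3) * Real.log n ≤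
          (signalConst K C ^ 2 * (θ n : ℝ) ^ 3) * (θ n * n ^ 2 * u ^ 2) := by linarith
      exact le_of_mul_le_mul_left this (by positivity)
    have e3 : b ≤ n * θ n * u := by
      have : (signalConst K C * (θ n : ℝ)) * b ≤
          (signalConst K C * (θ n : ℝ)) * (n * θ n * u) := by linarith
      exact le_of_mul_le_mul_left this (by positivity)
    -- For `n ≥ 3`, `log n ≥ 1`, so `e2` and `θ ≤ 1/2` already force `(nu)² ≥ 2`.
    have e4 : 1 ≤ n * u := by
      by_contra h
      push Not at h
      have h0 : 0 ≤ n * u := by positivity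
      have h6 : (n * u) ^ 2 < 1 := by nlinarith
      have h7 : (θ n : ℝ) * (n * u) ^ 2 ≤ 1 / 2 * (n * u) ^ 2 := by gcongr
      nlinarith
    exact exists_threshold hK hC hρ hρθ hθ ((div_le_iff₀ hρ).1 h2) e4 hus.le e1 e2 e3 (S n) (hS n)
  obtain ⟨lam, hlam⟩ := key.choice
  refine ⟨lam, ?_⟩
  have := ENNReal.tendsto_ofReal (tendsto_one_of_failure_le (fun n => measureReal_le_one) hlam)
  rw [ENNReal.ofReal_one] at this
  exact this.congr fun n => ofReal_measureReal

theorem awcdDebiased_consistent {K : ℕ} {C : ℝ} (hK : 1 ≤ K) (hC : 1 ≤ C) {θ ρ : ℕ → I}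
    (hpar : ∀ᶠ n : ℕ in atTop, 0 < (ρ n : ℝ) ∧ (ρ n : ℝ) < θ n ∧ (θ n : ℝ) ≤ 1 / 2)
    (hCρ : ∀ᶠ n : ℕ in atTop, (θ n : ℝ) / ρ n ≤ C)
    (hA : ∀ᶠ n : ℕ in atTop, signalConst K C ^ 2 * Real.log n * (θ n : ℝ) ^ 3 ≤
      (θ n - ρ n : ℝ) ^ 6 * n ^ 2)
    (hB : ∀ᶠ n : ℕ in atTop, signalConst K C ^ 2 * Real.log n * (θ n : ℝ) ^ 5 ≤
      (θ n - ρ n : ℝ) ^ 6 * n) :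
    ConsistentExactRecovery K θ ρ fun _ => awcdDebiased := by
  refine consistentExactRecovery_of_signal (b := 0) hK hC (fun n Y => debiasedEdgeCount Y Y)
    (fun n Y _ i j => by simp) hpar hCρ hA hB ?_
  filter_upwards [hpar] with n hn
  have : 0 < (θ n - ρ n : ℝ) := sub_pos.2 hn.2.1
  rw [zero_mul, zero_mul]
  positivity

theorem edgeCount_close {V : Type*} [Fintype V] [DecidableEq V] {Y : Matrix V V ℝ}
    (hY : IsAdj Y) (i j : V) :
    |edgeCount Y Y i j - debiasedEdgeCount Y Y i j| ≤ 1 * (localSize Y i + localSize Y j) := by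
  unfold edgeCount debiasedEdgeCount
  rw [sub_sub_cancel, one_mul]
  have hi := hY.localSize_nonneg i
  have hj := hY.localSize_nonneg j
  split_ifs with h
  · have h1 : 1 ≤ localSize Y i := by
      rw [hY.localSize_eq, ← h]
      exact Finset.single_le_sum (fun k _ => hY.nonneg i k) (Finset.mem_univ j)
    rw [abs_of_nonneg (by linarith)]
    linarith
  · rw [abs_zero]
    positivity

theorem awcdOriginal_consistent {K : ℕ} {C : ℝ} (hK : 1 ≤ K) (hC : 1 ≤ C) {θ ρ : ℕ → I}
    (hpar : ∀ᶠ n : ℕ in atTop, 0 < (ρ n : ℝ) ∧ (ρ n : ℝ) < θ n ∧ (θ n : ℝ) ≤ 1 / 2)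
    (hCρ : ∀ᶠ n : ℕ in atTop, (θ n : ℝ) / ρ n ≤ C)
    (hB : ∀ᶠ n : ℕ in atTop, signalConst K C ^ 2 * Real.log n * (θ n : ℝ) ^ 5 ≤
      (θ n - ρ n : ℝ) ^ 6 * n)
    (hb : ∀ᶠ n : ℕ in atTop, signalConst K C * θ n ≤ (θ n - ρ n : ℝ) ^ 3 * n) :
    ConsistentExactRecovery K θ ρ fun _ => awcdOriginal := by
  refine consistentExactRecovery_of_signal (b := 1) hK hC (fun n Y => edgeCount Y Y)
    (fun n Y hY i j => edgeCount_close hY i j) hpar hCρ ?_ hB (by simpa only [one_mul] using hb)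
  -- The edge noise condition is implied by the other two: `hb` forces `θ² n ≥ 1`, as `θ - ρ ≤ θ`,
  -- and then `hB` multiplied by `n` suffices.
  filter_upwards [hpar, hB, hb] with n h1 h2 h3
  obtain ⟨hρ, hρθ, hθ⟩ := h1
  have hθ0 : 0 < (θ n : ℝ) := hρ.trans hρθ
  have hg0 : 0 < (θ n - ρ n : ℝ) := sub_pos.2 hρθ
  have hn : (0 : ℝ) ≤ n := Nat.cast_nonneg n
  have hL : 1 ≤ signalConst K C := by
    have : (1 : ℝ) ≤ K := by exact_mod_cast hK
    linarith [le_signalConst hK hC]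
  have h4 : (1 : ℝ) ≤ θ n ^ 2 * n := by
    have e1 : (θ n - ρ n : ℝ) ^ 3 * n ≤ θ n ^ 3 * n := by gcongr; linarith
    have e2 : 1 * (θ n : ℝ) ≤ signalConst K C * θ n := by gcongr
    have e3 : (θ n : ℝ) * 1 ≤ θ n * (θ n ^ 2 * n) := by linarith
    exact le_of_mul_le_mul_left e3 hθ0
  have hlog : 0 ≤ Real.log n := Real.log_natCast_nonneg n
  calc _ ≤ signalConst K C ^ 2 * Real.log n * (θ n : ℝ) ^ 3 * (θ n ^ 2 * n) :=
        le_mul_of_one_le_right (by positivity) h4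
    _ = signalConst K C ^ 2 * Real.log n * (θ n : ℝ) ^ 5 * n := by ring
    _ ≤ (θ n - ρ n : ℝ) ^ 6 * n * n := by gcongr
    _ = _ := by ring

/-! ### From the stated rates to polynomial inequalities. -/

theorem eventually_mul_log_sq_le (M : ℝ) : ∀ᶠ n : ℕ in atTop, M * Real.log n ^ 2 ≤ n := by
  have h := (Real.isLittleO_pow_log_id_atTop (n := 2)).comp_tendsto
    (tendsto_natCast_atTop_atTop (R := ℝ))
  have h2 := h.bound (c := (|M| + 1)⁻¹) (by positivity)
  filter_upwards [h2] with n hn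
  simp only [Function.comp, id, Real.norm_eq_abs, Nat.abs_cast] at hn
  rw [abs_of_nonneg (sq_nonneg _), inv_mul_eq_div, le_div_iff₀ (by positivity)] at hn
  have := le_abs_self M
  nlinarith [sq_nonneg (Real.log n)]

theorem one_lt_of_quotient_le {C : ℝ} {θ ρ : ℕ → I}
    (hpar : ∀ᶠ n : ℕ in atTop, 0 < (ρ n : ℝ) ∧ (ρ n : ℝ) < θ n ∧ (θ n : ℝ) ≤ 1 / 2)
    (hCρ : ∀ᶠ n : ℕ in atTop, (θ n : ℝ) / ρ n ≤ C) : 1 < C := by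
  obtain ⟨n, h1, h2⟩ := (hpar.and hCρ).exists
  exact ((one_lt_div h1.1).2 h1.2.1).trans_le h2

theorem rpow_pow_eq {x a : ℝ} (hx : 0 ≤ x) (k : ℕ) {m : ℤ} (h : a * k = m) :
    (x ^ a) ^ k = x ^ m := by
  rw [← Real.rpow_natCast, ← Real.rpow_mul hx, h, Real.rpow_intCast]

theorem mainTheorem1 (K : ℕ) (hK : 2 ≤ K) (C : ℝ) :
    -- original algorithm, constant quotient
    (∃ c : ℝ, 0 < c ∧ ∀ θ ρ : ℕ → I,
      (∀ᶠ n : ℕ in atTop, 0 < (ρ n : ℝ) ∧ (ρ n : ℝ) < θ n ∧ (θ n : ℝ) ≤ 1 / 2) →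
      (∀ᶠ n : ℕ in atTop, (θ n : ℝ) / ρ n = C) →
      (∀ᶠ n : ℕ in atTop, c * (θ n : ℝ) > (n : ℝ) ^ (-(1 / 2) : ℝ)) →
      ConsistentExactRecovery K θ ρ fun _ => awcdOriginal) ∧
    -- original algorithm, bounded quotient
    (∃ c : ℝ, 0 < c ∧ ∀ θ ρ : ℕ → I,
      (∀ᶠ n : ℕ in atTop, 0 < (ρ n : ℝ) ∧ (ρ n : ℝ) < θ n ∧ (θ n : ℝ) ≤ 1 / 2) →
      (∀ᶠ n : ℕ in atTop, (θ n : ℝ) / ρ n ≤ C) →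
      (∀ᶠ n : ℕ in atTop, c * ((θ n : ℝ) - ρ n) >
        max ((n : ℝ) ^ (-(1 / 3) : ℝ) * (θ n : ℝ) ^ (1 / 3 : ℝ))
          ((n : ℝ) ^ (-(1 / 6) : ℝ) * (θ n : ℝ) ^ (5 / 6 : ℝ) *
            Real.log n ^ (1 / 6 : ℝ))) →
      ConsistentExactRecovery K θ ρ fun _ => awcdOriginal) ∧
    -- debiased algorithm, constant quotient
    (∃ c : ℝ, 0 < c ∧ ∀ θ ρ : ℕ → I,
      (∀ᶠ n : ℕ in atTop, 0 < (ρ n : ℝ) ∧ (ρ n : ℝ) < θ n ∧ (θ n : ℝ) ≤ 1 / 2) →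
      (∀ᶠ n : ℕ in atTop, (θ n : ℝ) / ρ n = C) →
      (∀ᶠ n : ℕ in atTop, c * (θ n : ℝ) >
        (n : ℝ) ^ (-(2 / 3) : ℝ) * Real.log n ^ (1 / 3 : ℝ)) →
      ConsistentExactRecovery K θ ρ fun _ => awcdDebiased) ∧
    -- debiased algorithm, bounded quotient
    (∃ c : ℝ, 0 < c ∧ ∀ θ ρ : ℕ → I,
      (∀ᶠ n : ℕ in atTop, 0 < (ρ n : ℝ) ∧ (ρ n : ℝ) < θ n ∧ (θ n : ℝ) ≤ 1 / 2) →
      (∀ᶠ n : ℕ in atTop, (θ n : ℝ) / ρ n ≤ C) →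
      (∀ᶠ n : ℕ in atTop, c * ((θ n : ℝ) - ρ n) >
        max ((n : ℝ) ^ (-(1 / 3) : ℝ) * (θ n : ℝ) ^ (1 / 2 : ℝ) *
            Real.log n ^ (1 / 6 : ℝ))
          ((n : ℝ) ^ (-(1 / 6) : ℝ) * (θ n : ℝ) ^ (5 / 6 : ℝ) *
            Real.log n ^ (1 / 6 : ℝ))) →
      ConsistentExactRecovery K θ ρ fun _ => awcdDebiased) := by

  have hK1 : 1 ≤ K := by omega
  -- For `C ≤ 1` no sequence satisfies the hypotheses, and any `c` works.
  by_cases hC : 1 < C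
  swap
  · refine ⟨⟨1, one_pos, ?_⟩, ⟨1, one_pos, ?_⟩, ⟨1, one_pos, ?_⟩, ⟨1, one_pos, ?_⟩⟩ <;>
      intro θ ρ h1 h2 _
    exacts [absurd (one_lt_of_quotient_le h1 (h2.mono fun _ h => h.le)) hC,
      absurd (one_lt_of_quotient_le h1 h2) hC,
      absurd (one_lt_of_quotient_le h1 (h2.mono fun _ h => h.le)) hC,
      absurd (one_lt_of_quotient_le h1 h2) hC]
  have hL := le_signalConst hK1 hC.le
  have hL1 : 1 ≤ signalConst K C := by
    have : (1 : ℝ) ≤ K := by exact_mod_cast hK1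
    linarith
  set L := signalConst K C with hLdef
  have hL0 : 0 < L := by linarith
  set κ : ℝ := 1 - 1 / C with hκ
  have hκ0 : 0 < κ := by
    rw [hκ, sub_pos, div_lt_one (by linarith)]; exact hC
  have hκ1 : κ ≤ 1 := by
    rw [hκ]
    have : 0 < 1 / C := by positivity
    linarith
  have hgap : ∀ {x y : ℝ}, 0 < y → x / y = C → x - y = κ * x := by
    intro x y hy hxy
    rw [div_eq_iff hy.ne'] at hxy
    rw [hκ, hxy]
    field_simp
  -- With constant quotient, `θ - ρ = κθ`. Since `κ ≤ 1 ≤ L`, all powers `c ^ k` with `k ≠ 0`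
  -- satisfy `c ^ k L² ≤ κ⁶ ≤ 1`, so one constant serves the four cases.
  set c : ℝ := κ ^ 6 / L ^ 2 with hc
  have hc0 : 0 < c := by positivity
  have hc1 : c ≤ 1 := by
    rw [hc, div_le_one (by positivity)]
    exact (pow_le_one₀ hκ0.le hκ1).trans (one_le_pow₀ hL1)
  have hcκ : ∀ k, k ≠ 0 → c ^ k * L ^ 2 ≤ κ ^ 6 := fun k hk => by
    have : c ^ k ≤ c := pow_le_of_le_one hc0.le hc1 hk
    rw [hc] at this ⊢
    rwa [le_div_iff₀ (by positivity)] at this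
  have hcL : ∀ k, k ≠ 0 → c ^ k * L ^ 2 ≤ 1 := fun k hk =>
    (hcκ k hk).trans (pow_le_one₀ hκ0.le hκ1)
  have hsix : ∀ {n : ℕ} {x g : ℝ}, 0 < n → 0 ≤ x →
      c * g > (n : ℝ) ^ (-(1 / 6) : ℝ) * x ^ (5 / 6 : ℝ) * Real.log n ^ (1 / 6 : ℝ) →
      L ^ 2 * Real.log n * x ^ 5 ≤ g ^ 6 * n := by
    intro n x g hn hx h
    have hn0 : (0 : ℝ) < n := by exact_mod_cast hn
    have hlog : 0 ≤ Real.log n := Real.log_natCast_nonneg n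
    have h6 := pow_le_pow_left₀ (by positivity) h.le 6
    rw [mul_pow, mul_pow, rpow_pow_eq hn0.le 6 (m := -1) (by norm_num),
      rpow_pow_eq hx 6 (m := 5) (by norm_num), rpow_pow_eq hlog 6 (m := 1) (by norm_num),
      zpow_neg_one, zpow_one, mul_pow, mul_assoc, inv_mul_le_iff₀ hn0] at h6
    have h7 : x ^ (5 : ℤ) = x ^ 5 := by norm_cast
    rw [h7] at h6
    calc L ^ 2 * Real.log n * x ^ 5 = L ^ 2 * (x ^ 5 * Real.log n) := by ring
      _ ≤ L ^ 2 * (n * (c ^ 6 * g ^ 6)) := by gcongr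
      _ = c ^ 6 * L ^ 2 * (g ^ 6 * n) := by ring
      _ ≤ 1 * (g ^ 6 * n) := by gcongr; exact hcL 6 (by norm_num)
      _ = _ := one_mul _
  refine ⟨⟨c, hc0, ?_⟩, ⟨c, hc0, ?_⟩, ⟨c, hc0, ?_⟩, ⟨c, hc0, ?_⟩⟩ <;> intro θ ρ h1 h2 h3
  · have hsq : ∀ᶠ n : ℕ in atTop, 1 ≤ c ^ 2 * (θ n : ℝ) ^ 2 * n := by
      filter_upwards [h3, eventually_gt_atTop 0] with n h hn
      have hn0 : (0 : ℝ) < n := by exact_mod_cast hn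
      have h6 := pow_le_pow_left₀ (by positivity) h.le 2
      rw [rpow_pow_eq hn0.le 2 (m := -1) (by norm_num), zpow_neg_one, mul_pow,
        inv_le_iff_one_le_mul₀ hn0] at h6
      exact h6
    refine awcdOriginal_consistent hK1 hC.le h1 (h2.mono fun _ h => h.le) ?_ ?_
    · filter_upwards [hsq, h1, h2, eventually_mul_log_sq_le ((L ^ 2 / κ ^ 6) ^ 2)] with n g1 g2 g3 g4
      rw [hgap g2.1 g3]
      have hθ0 : 0 < (θ n : ℝ) := g2.1.trans g2.2.1
      -- The rate gives `(θn)² ≥ n`, which eventually exceeds any multiple of `log² n`. Thus the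
      -- community count condition costs nothing beyond the bias condition.
      have e1 : (L ^ 2 / κ ^ 6 * Real.log n) ^ 2 ≤ (θ n * n) ^ 2 := by
        have : c ^ 2 * (θ n : ℝ) ^ 2 * n ≤ 1 * (θ n : ℝ) ^ 2 * n := by
          gcongr
          exact pow_le_one₀ hc0.le hc1
        have hn : (0 : ℝ) ≤ n := Nat.cast_nonneg n
        nlinarith
      have e2 := (pow_le_pow_iff_left₀ (by have := Real.log_natCast_nonneg n; positivity)
        (by positivity) two_ne_zero).1 e1
      rw [div_mul_eq_mul_div, div_le_iff₀ (by positivity)] at e2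
      calc _ ≤ (θ n : ℝ) * n * κ ^ 6 * (θ n : ℝ) ^ 5 := by gcongr
        _ = _ := by ring
    · filter_upwards [hsq, h1, h2] with n g1 g2 g3
      rw [hgap g2.1 g3]
      have hθ0 : 0 < (θ n : ℝ) := g2.1.trans g2.2.1
      have e1 : c ^ 2 * L ≤ κ ^ 3 := by
        have := hcκ 2 two_ne_zero
        calc c ^ 2 * L ≤ c ^ 2 * L ^ 2 := by
              gcongr
              exact le_self_pow₀ hL1 two_ne_zero
          _ ≤ κ ^ 6 := this
          _ ≤ κ ^ 3 := pow_le_pow_of_le_one hκ0.le hκ1 (by norm_num)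
      calc L * θ n ≤ L * θ n * (c ^ 2 * (θ n : ℝ) ^ 2 * n) :=
            le_mul_of_one_le_right (by positivity) g1
        _ = c ^ 2 * L * ((θ n : ℝ) ^ 3 * n) := by ring
        _ ≤ κ ^ 3 * ((θ n : ℝ) ^ 3 * n) := by gcongr
        _ = _ := by ring
  · refine awcdOriginal_consistent hK1 hC.le h1 h2 ?_ ?_
    · filter_upwards [h3, h1, eventually_gt_atTop 0] with n h g hn
      exact hsix hn (θ n).2.1 ((le_max_right _ _).trans_lt h)
    · filter_upwards [h3, h1, eventually_gt_atTop 0] with n h g hn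
      have hn0 : (0 : ℝ) < n := by exact_mod_cast hn
      have hg0 : 0 < (θ n - ρ n : ℝ) := sub_pos.2 g.2.1
      have hθ0 : 0 < (θ n : ℝ) := g.1.trans g.2.1
      have h6 := pow_le_pow_left₀ (by positivity) ((le_max_left _ _).trans_lt h).le 3
      rw [mul_pow, rpow_pow_eq hn0.le 3 (m := -1) (by norm_num),
        rpow_pow_eq hθ0.le 3 (m := 1) (by norm_num), zpow_neg_one, zpow_one, mul_pow,
        inv_mul_le_iff₀ hn0] at h6
      have e1 : c ^ 3 * L ≤ 1 := by
        refine le_trans ?_ (hcL 3 (by norm_num))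
        gcongr
        exact le_self_pow₀ hL1 two_ne_zero
      calc L * θ n ≤ L * (n * (c ^ 3 * (θ n - ρ n : ℝ) ^ 3)) := by gcongr
        _ = c ^ 3 * L * ((θ n - ρ n : ℝ) ^ 3 * n) := by ring
        _ ≤ 1 * ((θ n - ρ n : ℝ) ^ 3 * n) := by gcongr
        _ = _ := one_mul _
  · have hcube : ∀ᶠ n : ℕ in atTop, Real.log n ≤ c ^ 3 * (θ n : ℝ) ^ 3 * n ^ 2 := by
      filter_upwards [h3, eventually_gt_atTop 0] with n h hn
      have hn0 : (0 : ℝ) < n := by exact_mod_cast hn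
      have hlog : 0 ≤ Real.log n := Real.log_natCast_nonneg n
      have h6 := pow_le_pow_left₀ (by positivity) h.le 3
      rw [mul_pow, rpow_pow_eq hn0.le 3 (m := -2) (by norm_num),
        rpow_pow_eq hlog 3 (m := 1) (by norm_num), zpow_one, zpow_neg,
        inv_mul_le_iff₀ (by positivity), mul_pow] at h6
      have h7 : (n : ℝ) ^ (2 : ℤ) = (n : ℝ) ^ 2 := by norm_cast
      rw [h7] at h6
      linarith
    refine awcdDebiased_consistent hK1 hC.le h1 (h2.mono fun _ h => h.le) ?_ ?_
    · filter_upwards [hcube, h1, h2] with n g1 g2 g3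
      rw [hgap g2.1 g3]
      have hθ0 : 0 < (θ n : ℝ) := g2.1.trans g2.2.1
      calc L ^ 2 * Real.log n * (θ n : ℝ) ^ 3 ≤
            L ^ 2 * (c ^ 3 * (θ n : ℝ) ^ 3 * n ^ 2) * (θ n : ℝ) ^ 3 := by gcongr
        _ = c ^ 3 * L ^ 2 * ((θ n : ℝ) ^ 6 * n ^ 2) := by ring
        _ ≤ κ ^ 6 * ((θ n : ℝ) ^ 6 * n ^ 2) := by
            gcongr
            exact hcκ 3 (by norm_num)
        _ = _ := by ring
    · filter_upwards [hcube, h1, h2, eventually_mul_log_sq_le ((L ^ 2 / κ ^ 6) ^ 3)] with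
        n g1 g2 g3 g4
      rw [hgap g2.1 g3]
      have hθ0 : 0 < (θ n : ℝ) := g2.1.trans g2.2.1
      have hlog : 0 ≤ Real.log n := Real.log_natCast_nonneg n
      have hn : (0 : ℝ) ≤ n := Nat.cast_nonneg n
      -- The rate gives `(θn)³ ≥ n log n`, which eventually exceeds any multiple of `log³ n`, so
      -- only the edge noise condition is binding.
      have e1 : (L ^ 2 / κ ^ 6 * Real.log n) ^ 3 ≤ (θ n * n) ^ 3 := by
        calc (L ^ 2 / κ ^ 6 * Real.log n) ^ 3 =
              (L ^ 2 / κ ^ 6) ^ 3 * Real.log n ^ 2 * Real.log n := by ring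
          _ ≤ n * (c ^ 3 * (θ n : ℝ) ^ 3 * n ^ 2) := by gcongr
          _ = c ^ 3 * (θ n * n) ^ 3 := by ring
          _ ≤ 1 * (θ n * n) ^ 3 := by
              gcongr
              exact pow_le_one₀ hc0.le hc1
          _ = _ := one_mul _
      have e2 := (pow_le_pow_iff_left₀ (by positivity) (by positivity) three_ne_zero).1 e1
      rw [div_mul_eq_mul_div, div_le_iff₀ (by positivity)] at e2
      calc _ ≤ (θ n : ℝ) * n * κ ^ 6 * (θ n : ℝ) ^ 5 := by gcongr
        _ = _ := by ring
  · refine awcdDebiased_consistent hK1 hC.le h1 h2 ?_ ?_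
    · filter_upwards [h3, h1, eventually_gt_atTop 0] with n h g hn
      have hn0 : (0 : ℝ) < n := by exact_mod_cast hn
      have hlog : 0 ≤ Real.log n := Real.log_natCast_nonneg n
      have hθ0 : 0 < (θ n : ℝ) := g.1.trans g.2.1
      have h6 := pow_le_pow_left₀ (by positivity) ((le_max_left _ _).trans_lt h).le 6
      rw [mul_pow, mul_pow, rpow_pow_eq hn0.le 6 (m := -2) (by norm_num),
        rpow_pow_eq hθ0.le 6 (m := 3) (by norm_num), rpow_pow_eq hlog 6 (m := 1) (by norm_num),
        zpow_one, zpow_neg, mul_assoc, inv_mul_le_iff₀ (by positivity), mul_pow] at h6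
      have h7 : (n : ℝ) ^ (2 : ℤ) = (n : ℝ) ^ 2 := by norm_cast
      have h8 : (θ n : ℝ) ^ (3 : ℤ) = (θ n : ℝ) ^ 3 := by norm_cast
      rw [h7, h8] at h6
      calc L ^ 2 * Real.log n * (θ n : ℝ) ^ 3 = L ^ 2 * ((θ n : ℝ) ^ 3 * Real.log n) := by ring
        _ ≤ L ^ 2 * (n ^ 2 * (c ^ 6 * (θ n - ρ n : ℝ) ^ 6)) := by gcongr
        _ = c ^ 6 * L ^ 2 * ((θ n - ρ n : ℝ) ^ 6 * n ^ 2) := by ring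
        _ ≤ 1 * ((θ n - ρ n : ℝ) ^ 6 * n ^ 2) := by gcongr; exact hcL 6 (by norm_num)
        _ = _ := one_mul _
    · filter_upwards [h3, h1, eventually_gt_atTop 0] with n h g hn
      exact hsix hn (θ n).2.1 ((le_max_right _ _).trans_lt h)
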